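/- **Setting.** Let $\beta>1$ be a Pisot unit: an algebraic integer with minimal polynomial $x^d-c_1x^{d-1}-\cdots-c_d\in\mathbb Z[x]$, $|c_d|=1$, whose other Galois conjugates $\beta_2,\dots,\beta_d$ satisfy $|\beta_j|<1$; put $\beta_1=\beta$. Let $A\subset\mathbb Z[\beta]$ be finite and, for each $a\in A$, let $X_a\neq\emptyset$ be a finite union of intervals $[\ell_i,r_i)$, $i\in I_a$; assume that the $X_a$ are pairwise disjoint with union $X$ and that $\bigcup_{a\in A}(\beta X_a-a)=X$. Let $T:X\to X$, $Tx=\beta x-a$ for $x\in X_a$ (a right-continuous $\beta$-transformation), and let $\widetilde T:\widetilde X\to\widetilde X$, $\widetilde Tx=\beta x-a$ for $x\in\widetilde X_a$, where $\widetilde X_a=\bigcup_{i\in I_a}(\ell_i,r_i]$ and $\widetilde X=\bigcup_{a\in A}\widetilde X_a$. The $T$-expansion of $x\in X$ is $b(x)=b_1(x)b_2(x)\cdots$ with $b_k(x)=a$ if $T^{k-1}x\in X_a$; a sequence is $T$-admissible if it equals $b(x)$ for some $x\in X$. Let $$\mathcal S=\{(u_k)_{k\in\mathbb Z}\in A^{\mathbb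 Z}:\ u_ku_{k+1}\cdots\text{ is $T$-admissible for all }k\in\mathbb Z\},$$ and let $\bar{\mathcal S}$ be its closure in the product topology. Let $\mathbf v_j=\nu_j(\beta_j^{d-1},\dots,\beta_j,1)^t$, $1\le j\le d$, with the unique $\nu_j\in\mathbb C$ such that $\mathbf v_1+\cdots+\mathbf v_d=(1,0,\dots,0)^t$. Let $H\subset\mathbb R^d$ be the hyperplane spanned by the real and imaginary parts of $\mathbf v_2,\dots,\mathbf v_d$, and let $\pi_1:\mathbb R^d\to\mathbb R$ be given by $\pi_1(x\mathbf v_1+\mathbf y)=x$ for $x\in\mathbb R$, $\mathbf y\in H$. Let $\Gamma_j:\mathbb Q(\beta)\to\mathbb Q(\beta_j)$ be the field isomorphism with $\Gamma_j(\beta)=\beta_j$, and put $\Phi(x)=\sum_{j=2}^d\Gamma_j(x)\mathbf v_j\in H$ for $x\in\mathbb Q(\beta)$, and $\varphi(w)=\sum_{k\le0}\Phi(w_k\beta^{-k})$ for $w=\cdots w_{-1}w_0$ with $w_k\in A$. For $u\in A^{\mathbb Z}$ let $$\psi(u)=\Big(\sum_{k\ge1}u_k\beta^{-k}\Big)\mathbf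 v_1-\varphi(\cdots u_{-1}u_0).$$ The natural extension domain is $\widehat X=\psi(\mathcal S)$, and $\widehat Y=\psi(\bar{\mathcal S})$ is its closure. With $\lambda^d$ the Lebesgue measure on $\mathbb R^d$, let $\mu$ be the measure $\mu(E)=\lambda^d(\widehat X\cap\pi_1^{-1}(E))$. For $x\in X$ let $\mathcal D_x=\{\varphi(w):\ w\cdot b(x)\in\mathcal S\}$, and for $x\in\mathbb Z[\beta]\cap X$ let $\mathcal T_x=\Phi(x)+\mathcal D_x\subset H$. Finally let $$\mathcal V=(X\setminus\widetilde X)\cup\bigcup_{x\in X\cap\widetilde X}\ \bigcup_{1\le k<m_x}\{T^kx,\widetilde T^kx\}\cap X,$$ where $m_x$ is the least $m\ge1$ with $\widetilde T^mx=T^mx$ ($m_x=\infty$ if there is none). A family of translates $t_i+D_i$ of sets $D_i$ is a *tiling* of $H$ (of $\mathbb R^d$) if there are only finitely many different sets $D_i$, every $D_i$ is compact and is the closure of its interior, the family is locally finite (every point has a ball that meets $t_i+D_i$ for only finitely many indices $i$), it covers the space, and almost every point (for Lebesgue measure) lies in $t_i+D_i$ for exactly one index $i$. **Proposition.** Assume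 that $\mu$ has support $X$ (that is, every neighbourhood of every point of $X$ has positive $\mu$-measure) and that $\mathcal V$ is finite. Then the family $\{\mathbf x+\widehat Y\}_{\mathbf x\in\mathbb Z^d}$ is a tiling of $\mathbb R^d$ if and only if the family $\{\mathcal T_x\}_{x\in\mathbb Z[\beta]\cap X}$ is a tiling of $H$. Equivalently, $\widehat X$ gives a tiling of the torus $\mathbb T^d=\mathbb R^d/\mathbb Z^d$: almost every point of $\mathbb T^d$ is the residue class of exactly one point of $\widehat X$. -/

import Mathlib

open Polynomial Set MeasureTheory Metric
open scoped Pointwise Topology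

noncomputable section

namespace BetaTiling

/-! ### Right-continuous beta-transformations -/

/-- A right-continuous `β`-transformation: a finite digit set `A ⊂ ℝ` and, for every digit `a`, a
finite union `X_a` of intervals `[ℓ, r)`, `(ℓ, r) ∈ I a`. The sets `X_a`, `a ∈ A`, are non-empty
and pairwise disjoint, and the map `x ↦ β x - a` for `x ∈ X_a` sends their union `X` onto `X`. -/
structure BetaTransformation (β : ℝ) where
  A : Finset ℝ
  I : ℝ → Finset (ℝ × ℝ)
  nonempty : ∀ a ∈ A, (⋃ p ∈ I a, Ico p.1 p.2).Nonempty
  disjoint : ∀ a ∈ A, ∀ a' ∈ A, a ≠ a' →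
    Disjoint (⋃ p ∈ I a, Ico p.1 p.2) (⋃ p ∈ I a', Ico p.1 p.2)
  surj : (⋃ a ∈ A, (fun x : ℝ => β * x - a) '' (⋃ p ∈ I a, Ico p.1 p.2)) =
    ⋃ a ∈ A, ⋃ p ∈ I a, Ico p.1 p.2

open Classical in
/-- The digit `a ∈ A` with `x ∈ P a` (and `0` if there is none). -/
def digitOf (A : Finset ℝ) (P : ℝ → Set ℝ) (x : ℝ) : ℝ :=
  if h : ∃ a ∈ A, x ∈ P a then h.choose else 0

namespace BetaTransformation

variable {β : ℝ} (T : BetaTransformation β)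

/-- `X_a`, a union of left-closed, right-open intervals. -/
def piece (a : ℝ) : Set ℝ := ⋃ p ∈ T.I a, Ico p.1 p.2

/-- `X̃_a`, the union of the corresponding left-open, right-closed intervals. -/
def pieceL (a : ℝ) : Set ℝ := ⋃ p ∈ T.I a, Ioc p.1 p.2

/-- `X`. -/
def X : Set ℝ := ⋃ a ∈ T.A, T.piece a

/-- `X̃`. -/
def XL : Set ℝ := ⋃ a ∈ T.A, T.pieceL a

/-- The transformation `T x = β x - a` for `x ∈ X_a` (only its values on `X` matter). -/
def map (x : ℝ) : ℝ := β * x - digitOf T.A T.piece x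

/-- The left-continuous transformation `T̃ x = β x - a` for `x ∈ X̃_a` (only its values on `X̃`
matter). -/
def mapL (x : ℝ) : ℝ := β * x - digitOf T.A T.pieceL x

/-- The `T`-expansion `b(x)`; the entry with index `n` is the digit `b_{n+1}(x)`. -/
def expansion (x : ℝ) (n : ℕ) : ℝ := digitOf T.A T.piece (T.map^[n] x)

/-- A right-infinite sequence is `T`-admissible if it is the `T`-expansion of a point of `X`. -/
def Admissible (u : ℕ → ℝ) : Prop := ∃ x ∈ T.X, u = T.expansion x

/-- The set `𝒮` of two-sided sequences `(u_k)`, `k ∈ ℤ`, of digits such that `u_k u_{k+1} ⋯` is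
`T`-admissible for all `k`. -/
def seqSpace : Set (ℤ → ℝ) :=
  {u | (∀ k, u k ∈ T.A) ∧ ∀ k : ℤ, T.Admissible fun n : ℕ => u (k + n)}

/-- The set `𝒱`. The condition `1 ≤ k < m_x`, where `m_x` is the smallest `m ≥ 1` with
`T̃^m x = T^m x` (or `∞`), is spelled out as `T̃^m x ≠ T^m x` for `1 ≤ m ≤ k`. -/
def V : Set ℝ :=
  (T.X \ T.XL) ∪ {y | y ∈ T.X ∧ ∃ x ∈ T.X ∩ T.XL, ∃ k : ℕ, 1 ≤ k ∧
    (∀ m, 1 ≤ m → m ≤ k → T.mapL^[m] x ≠ T.map^[m] x) ∧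
    (y = T.map^[k] x ∨ y = T.mapL^[k] x)}

theorem digitOf_eq {a x : ℝ} (ha : a ∈ T.A) (hx : x ∈ T.piece a) :
    digitOf T.A T.piece x = a := by
  have h : ∃ a ∈ T.A, x ∈ T.piece a := ⟨a, ha, hx⟩
  rw [digitOf, dif_pos h]
  by_contra hne
  exact Set.disjoint_left.1 (T.disjoint _ h.choose_spec.1 _ ha hne) h.choose_spec.2 hx

end BetaTransformation

/-! ### Pisot units and the contracting hyperplane -/

/-- `β > 1` is a Pisot unit: an algebraic integer whose minimal polynomial has constant
coefficient `± 1` and all of whose other Galois conjugates have modulus `< 1`. -/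
def IsPisotUnit (β : ℝ) : Prop :=
  1 < β ∧ IsIntegral ℤ β ∧ |(minpoly ℤ β).coeff 0| = 1 ∧
    ∀ z : ℂ, aeval z (minpoly ℤ β) = 0 → z ≠ (β : ℂ) → ‖z‖ < 1

/-- The degree `d` of `β`. -/
abbrev deg (β : ℝ) : ℕ := (minpoly ℤ β).natDegree

/-- The space `ℝ^d`. -/
abbrev Space (β : ℝ) : Type := EuclideanSpace ℝ (Fin (deg β))

/-- The finite set of Galois conjugates of `β` (including `β`). -/
def conjugates (β : ℝ) : Finset ℂ := ((minpoly ℤ β).aroots ℂ).toFinset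

open Classical in
/-- For a conjugate `z` of `β`, the isomorphism `Γ : ℚ(β) → ℚ(z)` with `Γ(β) = z`: if `x = p(β)`
with `p ∈ ℚ[X]`, then `Γ(x) = p(z)`. (It is extended by `0` to `ℝ ∖ ℚ(β)`.) -/
def gal (β : ℝ) (z : ℂ) (x : ℝ) : ℂ :=
  if h : ∃ p : ℚ[X], aeval β p = x then aeval z h.choose else 0

theorem gal_aeval {β : ℝ} (hβ : IsIntegral ℤ β) {z : ℂ} (hz : aeval z (minpoly ℤ β) = 0)
    (p : ℚ[X]) : gal β z (aeval β p) = aeval z p := by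
  have h : ∃ q : ℚ[X], aeval β q = aeval β p := ⟨p, rfl⟩
  rw [gal, dif_pos h]
  have h1 : aeval β (h.choose - p) = 0 := by rw [map_sub, h.choose_spec, sub_self]
  obtain ⟨q, hq⟩ := minpoly.dvd ℚ β h1
  have h2 : aeval z (minpoly ℚ β) = 0 := by
    rw [minpoly.isIntegrallyClosed_eq_field_fractions' ℚ hβ, aeval_map_algebraMap, hz]
  have h3 : aeval z (h.choose - p) = 0 := by rw [hq, map_mul, h2, zero_mul]
  rwa [map_sub, sub_eq_zero] at h3

/-- The companion matrix `M_β` of the minimal polynomial `x^d - c_1 x^{d-1} - ⋯ - c_d`. -/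
def companion (β : ℝ) : Matrix (Fin (deg β)) (Fin (deg β)) ℝ :=
  fun i j => if (i : ℕ) = 0 then -((minpoly ℤ β).coeff (deg β - 1 - j) : ℝ)
    else if (i : ℕ) = j + 1 then 1 else 0

/-- The right eigenvector `v_z = ν_z (z^{d-1}, …, z, 1)ᵗ` of `M_β`, where `ν_z = 1 / f'(z)` with the
minimal polynomial `f` of `β`. These are the factors for which `∑ v_z = e_1`. -/
def eigvec (β : ℝ) (z : ℂ) (i : Fin (deg β)) : ℂ :=
  (aeval z (derivative (minpoly ℤ β)))⁻¹ * z ^ (deg β - 1 - i)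

theorem companion_mulVec_eigvec {β : ℝ} (hβ : IsIntegral ℤ β) {z : ℂ}
    (hz : aeval z (minpoly ℤ β) = 0) :
    ((companion β).map (algebraMap ℝ ℂ)).mulVec (eigvec β z) = z • eigvec β z := by
  have hd : 0 < deg β := minpoly.natDegree_pos hβ
  funext i
  simp only [Matrix.mulVec, dotProduct, Matrix.map_apply, Pi.smul_apply, smul_eq_mul, eigvec,
    companion]
  by_cases hi : (i : ℕ) = 0
  · have h0 : ∑ k ∈ Finset.range (deg β), ((minpoly ℤ β).coeff k : ℂ) * z ^ k + z ^ deg β = 0 := by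
      have h := hz
      rw [aeval_eq_sum_range, Finset.sum_range_succ] at h
      have hm : (minpoly ℤ β).coeff (minpoly ℤ β).natDegree = 1 := minpoly.monic hβ
      rw [hm] at h
      simpa [deg] using h
    rw [← Finset.sum_range_reflect, Finset.sum_range] at h0
    have hs : ∀ j : Fin (deg β), (algebraMap ℝ ℂ) (if (i : ℕ) = 0 then
        -((minpoly ℤ β).coeff (deg β - 1 - j) : ℝ) else if (i : ℕ) = j + 1 then 1 else 0) *
        ((aeval z (derivative (minpoly ℤ β)))⁻¹ * z ^ (deg β - 1 - (j : ℕ))) =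
        -(aeval z (derivative (minpoly ℤ β)))⁻¹ *
          (((minpoly ℤ β).coeff (deg β - 1 - j) : ℂ) * z ^ (deg β - 1 - (j : ℕ))) := by
      intro j
      rw [if_pos hi]
      simp
      ring
    rw [Finset.sum_congr rfl fun j _ => hs j, ← Finset.mul_sum, eq_neg_of_add_eq_zero_left h0, hi]
    have : z ^ deg β = z * z ^ (deg β - 1) := by
      rw [← pow_succ', Nat.sub_add_cancel hd]
    rw [this, Nat.sub_zero]
    ring
  · have hi' := i.2
    rw [Finset.sum_eq_single (⟨i - 1, by omega⟩ : Fin (deg β))]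
    · rw [if_neg hi, if_pos (by simp; omega)]
      have : deg β - 1 - ((i : ℕ) - 1) = (deg β - 1 - i) + 1 := by omega
      simp only [this, pow_succ, map_one]
      ring
    · intro j _ hj
      rw [if_neg hi, if_neg, map_zero, zero_mul]
      intro h
      exact hj (Fin.ext (by simp; omega))
    · simp

theorem sum_eigvec {β : ℝ} (hβ : IsIntegral ℤ β) (i : Fin (deg β)) :
    ∑ z ∈ conjugates β, eigvec β z i = if (i : ℕ) = 0 then 1 else 0 := by
  have hd : 0 < deg β := minpoly.natDegree_pos hβ
  have hi := i.2
  set f : ℂ[X] := (minpoly ℤ β).map (algebraMap ℤ ℂ) with hf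
  have hfm : f.Monic := (minpoly.monic hβ).map _
  have hfd : f.natDegree = deg β := (minpoly.monic hβ).natDegree_map _
  have hsep : f.Separable := by
    have h := (minpoly.irreducible (hβ.tower_top (A := ℚ))).separable
    rw [minpoly.isIntegrallyClosed_eq_field_fractions' ℚ hβ] at h
    have h2 := h.map (f := algebraMap ℚ ℂ)
    rwa [Polynomial.map_map, ← IsScalarTower.algebraMap_eq] at h2
  have hnd : f.roots.Nodup := nodup_roots hsep
  have hc : conjugates β = f.roots.toFinset := rfl
  have hspl : f.Splits := IsAlgClosed.splits f
  have hcard : (conjugates β).card = deg β := by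
    rw [hc, Multiset.toFinset_card_of_nodup hnd, ← hfd]
    exact hspl.natDegree_eq_card_roots.symm
  have hnod : Lagrange.nodal (conjugates β) (id : ℂ → ℂ) = f := by
    rw [Lagrange.nodal, hc, Finset.prod, Multiset.toFinset_val, hnd.dedup]
    exact (hspl.eq_prod_roots_of_monic hfm).symm
  have hP : (X ^ (deg β - 1 - i) : ℂ[X]).degree < (conjugates β).card := by
    rw [degree_X_pow, hcard]
    exact_mod_cast (by omega : deg β - 1 - (i : ℕ) < deg β)
  have key := Lagrange.coeff_eq_sum (s := conjugates β) (v := (id : ℂ → ℂ))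
    (injOn_id _) hP
  rw [hcard, coeff_X_pow] at key
  have hiff : (deg β - 1 = deg β - 1 - (i : ℕ)) ↔ (i : ℕ) = 0 := by omega
  simp only [hiff] at key
  rw [key]
  refine Finset.sum_congr rfl fun z hz => ?_
  have h1 := Lagrange.eval_nodal_derivative_eval_node_eq (v := (id : ℂ → ℂ)) hz
  rw [hnod, Lagrange.eval_nodal, hf, derivative_map, id, eval_map_algebraMap] at h1
  rw [eigvec, h1]
  simp [div_eq_inv_mul]

/-- The real part of the vector `v_z`. -/
def eigvecRe (β : ℝ) (z : ℂ) : Space β := WithLp.toLp 2 fun i => (eigvec β z i).re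

/-- The imaginary part of the vector `v_z`. -/
def eigvecIm (β : ℝ) (z : ℂ) : Space β := WithLp.toLp 2 fun i => (eigvec β z i).im

/-- The vector `v_1`, which belongs to the conjugate `β` itself and is real. -/
def v1 (β : ℝ) : Space β := eigvecRe β (β : ℂ)

/-- The hyperplane `H`, spanned by the real and imaginary parts of `v_2, …, v_d`. -/
def hyperplane (β : ℝ) : Submodule ℝ (Space β) :=
  Submodule.span ℝ (⋃ z ∈ (conjugates β).erase (β : ℂ), {eigvecRe β z, eigvecIm β z})

/-- Lebesgue measure `λ^{d-1}` on `H`. -/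
def hyperplaneMeasure (β : ℝ) : Measure (hyperplane β) :=
  (stdOrthonormalBasis ℝ (hyperplane β)).toBasis.addHaar

/-- The map `Φ : ℚ(β) → H`, `Φ(x) = ∑_{j ≥ 2} Γ_j(x) v_j`. The sum is invariant under complex
conjugation, so it equals the sum of the real parts of its terms. -/
def Phi (β : ℝ) (x : ℝ) : hyperplane β :=
  ⟨∑ z ∈ (conjugates β).erase (β : ℂ),
      ((gal β z x).re • eigvecRe β z - (gal β z x).im • eigvecIm β z),
    Submodule.sum_mem _ fun z hz => Submodule.sub_mem _
      (Submodule.smul_mem _ _ (Submodule.subset_span (mem_biUnion hz (by simp))))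
      (Submodule.smul_mem _ _ (Submodule.subset_span (mem_biUnion hz (by simp))))⟩

open Classical in
/-- The projection `π_1` with `π_1(𝐱) = x` if `𝐱 = x v_1 + 𝐲` for some `𝐲 ∈ H`. -/
def proj1 (β : ℝ) (y : Space β) : ℝ :=
  if h : ∃ x : ℝ, y - x • v1 β ∈ hyperplane β then h.choose else 0

/-- `φ(w) = ∑_{k ≤ 0} Φ(w_k β^{-k})` for a left-infinite sequence `w`; the entry of `w` with index
`n` is `w_{-n}`. -/
def phi (β : ℝ) (w : ℕ → ℝ) : hyperplane β := ∑' n : ℕ, Phi β (w n * β ^ n)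

/-- `ψ(u) = (∑_{k ≥ 1} u_k β^{-k}) v_1 - φ(⋯ u_{-1} u_0)`. -/
def psi (β : ℝ) (u : ℤ → ℝ) : Space β :=
  (∑' n : ℕ, u (n + 1) * (β ^ (n + 1))⁻¹) • v1 β - (phi β fun n : ℕ => u (-(n : ℤ)) : Space β)

/-- The two-sided sequence `w · b = ⋯ w_{-1} w_0 b_1 b_2 ⋯`, where the left-infinite sequence is
given as `n ↦ w_{-n}` and the right-infinite one as `n ↦ b_{n+1}`. -/
def concat (w b : ℕ → ℝ) (k : ℤ) : ℝ := if k ≤ 0 then w (-k).toNat else b (k - 1).toNat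

/-! ### Tilings -/

/-- The translates `t i + D i` of the sets `D i` form a multiple tiling of `E` with covering degree
`m`. Tiles are counted by their indices; "almost all" refers to the measure `μ`. -/
structure IsMultipleTiling {E ι : Type*} [NormedAddCommGroup E] [MeasurableSpace E]
    (μ : Measure E) (t : ι → E) (D : ι → Set E) (m : ℕ) : Prop where
  finite_prototiles : (range D).Finite
  isCompact : ∀ i, IsCompact (D i)
  locallyFinite : ∀ y : E, ∃ r > 0, {i | ((t i +ᵥ D i) ∩ ball y r).Nonempty}.Finite
  covers : ∀ y : E, ∃ i, y ∈ t i +ᵥ D i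
  closure_interior : ∀ i, closure (interior (D i)) = D i
  one_le : 1 ≤ m
  ae_covered : ∀ᵐ y ∂μ, {i | y ∈ t i +ᵥ D i}.encard = m

/-- A tiling is a multiple tiling with covering degree `1`. -/
def IsTiling {E ι : Type*} [NormedAddCommGroup E] [MeasurableSpace E]
    (μ : Measure E) (t : ι → E) (D : ι → Set E) : Prop := IsMultipleTiling μ t D 1

namespace BetaTransformation

variable {β : ℝ} (T : BetaTransformation β)

/-- The natural extension domain `X̂ = ψ(𝒮)`. -/
def natExt : Set (Space β) := psi β '' T.seqSpace

/-- The compact set `Ŷ = ψ(𝒮̄)`, where the closure is taken in the product topology. -/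
def natExtClosure : Set (Space β) := psi β '' closure T.seqSpace

/-- The invariant measure `μ = λ^d ∘ π⁻¹`, where `π` is the restriction of `π_1` to `X̂`. -/
def invMeasure : Measure ℝ := ((volume : Measure (Space β)).restrict T.natExt).map (proj1 β)

/-- The set `𝒟_x = {φ(w) : w · b(x) ∈ 𝒮}`. -/
def tileD (x : ℝ) : Set (hyperplane β) :=
  phi β '' {w | concat w (T.expansion x) ∈ T.seqSpace}

/-- The index set `ℤ[β] ∩ X`. -/
def tileIndex : Set ℝ := {x | x ∈ Algebra.adjoin ℤ {β} ∧ x ∈ T.X}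

/-- The family of the tiles `𝒯_x = Φ(x) + 𝒟_x`, `x ∈ ℤ[β] ∩ X`, is a tiling of `H`. -/
def TilesHyperplane : Prop :=
  IsTiling (hyperplaneMeasure β) (fun x : T.tileIndex => Phi β x) fun x => T.tileD x

/-- The family of the sets `𝐱 + Ŷ`, `𝐱 ∈ ℤ^d`, is a tiling of `ℝ^d`. -/
def TilesSpace : Prop :=
  IsTiling (volume : Measure (Space β))
    (fun n : Fin (deg β) → ℤ => (WithLp.toLp 2 fun i => (n i : ℝ) : Space β))
    fun _ => T.natExtClosure

/-- The natural extension domain `X̂` is a tiling of the torus `𝕋^d = ℝ^d / ℤ^d`: almost every point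
of the torus is the residue class of exactly one point of `X̂`. -/
def TilesTorus : Prop :=
  ∀ᵐ p : UnitAddTorus (Fin (deg β)),
    ∃! y : Space β, y ∈ T.natExt ∧ (fun i => ((y i : ℝ) : UnitAddCircle)) = p

end BetaTransformation

end BetaTiling

end

open Polynomial Set MeasureTheory Metric
open scoped Pointwise Topology

noncomputable section

namespace BetaTiling

/-! ### The isomorphisms `Γ` on `ℤ[β]` -/

section Gal

variable {β : ℝ}

/-! In the coordinates `(x, h) ↦ x v_1 + h` (`coordEquiv`), the map `ξ ↦ ξ v_1 + Φ(ξ)` (`embed`) is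
an additive bijection from `ℤ[β]` onto `ℤ^d`, and the natural extension domain has the fiber `-𝒟_x`
over `x ∈ X`. Hence `x v_1 + h` lies in exactly one lattice translate of `X̂` iff `CoveredOnce x h`,
and on the slice `x = 0` the substitution `ξ ↦ -ξ` turns this into: `-h` lies in exactly one tile
`𝒯_i`. All three tiling statements thus reduce to "almost every point is covered once", on `ℝ^d` or
on the single slice `H`.

Passing between the two rests on the piecewise constancy of `x ↦ 𝒟_x`. It makes the covering of a
bounded part of `H` locally constant to the right in `x`. By Fubini, a good covering of `ℝ^d` gives
good slices arbitrarily close to `0` on the right, hence a good slice `0`. Conversely, translation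
by `ξ ∈ ℤ[β]` carries slice `0` to slice `ξ`, and `ℤ[β]` is dense (`ae_existsUnique_intVec_iff`).

Piecewise constancy (`fiber_eq_of_Icc`) comes from finite approximations: up to `K ρ^n`, the set
`𝒟_x` is the image under `Φ` of the numbers `β^n z - x` with `T^n z = x`. This finite set is locally
constant to the right in `x`, and away from `𝒱` it also is locally constant to the left, except at a
number of points bounded independently of `n`: the images under the `n`-th iterates of the points in
just one of the domains `X`, `X̃`. So on an interval of `X` with no point of `𝒱` beyond its left
end, the distance from a fixed point to `𝒟_t` is continuous in `t`, and its values lie in boundedly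
many balls of radius `2 K ρ^n`. Letting `n → ∞` shows that it is constant.

The other tiling axioms follow. Boundedness and discreteness give local finiteness; the support of
`μ` makes every `𝒟_x` of positive measure, so almost unique covering produces interior points, and
self-similarity spreads them densely (`closure_interior_tileD`). Finally `Ŷ` differs from `X̂` only
over finitely many `x`, thus by a null set. -/

theorem mem_conjugates (hβ : IsIntegral ℤ β) {z : ℂ} :
    z ∈ conjugates β ↔ aeval z (minpoly ℤ β) = 0 := by
  rw [conjugates, Multiset.mem_toFinset, mem_aroots]
  exact and_iff_right (minpoly.ne_zero hβ)

theorem ofReal_mem_conjugates (hβ : IsIntegral ℤ β) : (β : ℂ) ∈ conjugates β := by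
  rw [mem_conjugates hβ]
  have := aeval_algebraMap_apply ℂ β (minpoly ℤ β)
  rw [minpoly.aeval, map_zero] at this
  exact this

theorem exists_rat_poly {x : ℝ} (hx : x ∈ Algebra.adjoin ℤ {β}) :
    ∃ p : ℚ[X], aeval β p = x := by
  rw [Algebra.adjoin_singleton_eq_range_aeval] at hx
  obtain ⟨p, rfl⟩ := hx
  exact ⟨p.map (algebraMap ℤ ℚ), aeval_map_algebraMap ℚ β p⟩

theorem self_mem_adjoin : β ∈ Algebra.adjoin ℤ {β} := Algebra.self_mem_adjoin_singleton ℤ β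

theorem gal_add (hβ : IsIntegral ℤ β) {z : ℂ} (hz : z ∈ conjugates β) {x y : ℝ}
    (hx : x ∈ Algebra.adjoin ℤ {β}) (hy : y ∈ Algebra.adjoin ℤ {β}) :
    gal β z (x + y) = gal β z x + gal β z y := by
  rw [mem_conjugates hβ] at hz
  obtain ⟨p, rfl⟩ := exists_rat_poly hx
  obtain ⟨q, rfl⟩ := exists_rat_poly hy
  rw [← map_add, gal_aeval hβ hz, gal_aeval hβ hz, gal_aeval hβ hz, map_add]

theorem gal_mul (hβ : IsIntegral ℤ β) {z : ℂ} (hz : z ∈ conjugates β) {x y : ℝ}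
    (hx : x ∈ Algebra.adjoin ℤ {β}) (hy : y ∈ Algebra.adjoin ℤ {β}) :
    gal β z (x * y) = gal β z x * gal β z y := by
  rw [mem_conjugates hβ] at hz
  obtain ⟨p, rfl⟩ := exists_rat_poly hx
  obtain ⟨q, rfl⟩ := exists_rat_poly hy
  rw [← map_mul, gal_aeval hβ hz, gal_aeval hβ hz, gal_aeval hβ hz, map_mul]

theorem gal_self (hβ : IsIntegral ℤ β) {z : ℂ} (hz : z ∈ conjugates β) : gal β z β = z := by
  rw [mem_conjugates hβ] at hz
  simpa using gal_aeval hβ hz (X : ℚ[X])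

theorem gal_one (hβ : IsIntegral ℤ β) {z : ℂ} (hz : z ∈ conjugates β) : gal β z 1 = 1 := by
  rw [mem_conjugates hβ] at hz
  simpa using gal_aeval hβ hz (1 : ℚ[X])

theorem gal_ofReal (hβ : IsIntegral ℤ β) {x : ℝ} (hx : x ∈ Algebra.adjoin ℤ {β}) :
    gal β (β : ℂ) x = x := by
  have hz := (mem_conjugates hβ).1 (ofReal_mem_conjugates hβ)
  obtain ⟨p, rfl⟩ := exists_rat_poly hx
  rw [gal_aeval hβ hz]
  exact aeval_algebraMap_apply ℂ β p

theorem gal_mul_pow (hβ : IsIntegral ℤ β) {z : ℂ} (hz : z ∈ conjugates β) {x : ℝ}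
    (hx : x ∈ Algebra.adjoin ℤ {β}) (n : ℕ) : gal β z (x * β ^ n) = gal β z x * z ^ n := by
  induction n with
  | zero => simp
  | succ n ih =>
    rw [pow_succ, ← mul_assoc, gal_mul hβ hz (mul_mem hx (pow_mem self_mem_adjoin n))
      self_mem_adjoin, ih, gal_self hβ hz, pow_succ, mul_assoc]

end Gal

/-! ### Real parts of multiples of the eigenvectors -/

/-- The vector of real parts `Re (c v_z)`. -/
def reVec (β : ℝ) (z : ℂ) : ℂ →ₗ[ℝ] Space β where
  toFun c := WithLp.toLp 2 fun i => (c * eigvec β z i).re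
  map_add' a b := by ext i; simp [add_mul]
  map_smul' a b := by ext i; simp [mul_assoc]

section Vectors

variable {β : ℝ}

theorem reVec_apply (z c : ℂ) (i : Fin (deg β)) :
    reVec β z c i = (c * eigvec β z i).re := rfl

theorem reVec_eq (z c : ℂ) :
    reVec β z c = c.re • eigvecRe β z - c.im • eigvecIm β z := by
  ext i
  simp [reVec_apply, eigvecRe, eigvecIm]

theorem reVec_ofReal (x : ℝ) : reVec β (β : ℂ) (x : ℂ) = x • v1 β := by
  rw [reVec_eq, v1]; simp

theorem reVec_mem_hyperplane {z : ℂ} (hz : z ∈ (conjugates β).erase (β : ℂ)) (c : ℂ) :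
    reVec β z c ∈ hyperplane β := by
  rw [reVec_eq]
  exact Submodule.sub_mem _
    (Submodule.smul_mem _ _ (Submodule.subset_span (mem_biUnion hz (by simp))))
    (Submodule.smul_mem _ _ (Submodule.subset_span (mem_biUnion hz (by simp))))

/-- The spanning vectors are `Re (c v_z)` for `c = 1` and `c = -i`. Allowing every complex `c` makes
the generators stable under `M_β`, which acts by `c ↦ z c`. -/
theorem hyperplane_induction {p : Space β → Prop}
    (hre : ∀ z ∈ (conjugates β).erase (β : ℂ), ∀ c, p (reVec β z c)) (h0 : p 0)
    (hadd : ∀ x y, x ∈ hyperplane β → y ∈ hyperplane β → p x → p y → p (x + y))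
    (hsmul : ∀ (a : ℝ) (x), x ∈ hyperplane β → p x → p (a • x))
    {y : Space β} (hy : y ∈ hyperplane β) : p y := by
  refine Submodule.span_induction (p := fun x _ => p x) ?_ h0 hadd hsmul hy
  intro x hx
  simp only [mem_iUnion, mem_insert_iff, mem_singleton_iff] at hx
  obtain ⟨z, hz, rfl | rfl⟩ := hx
  · have := hre z hz 1
    rw [reVec_eq] at this
    simpa using this
  · have := hre z hz (-Complex.I)
    rw [reVec_eq] at this
    simpa using this

theorem coe_Phi (x : ℝ) : (Phi β x : Space β) =
    ∑ z ∈ (conjugates β).erase (β : ℂ), reVec β z (gal β z x) := by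
  simp only [reVec_eq]; rfl

theorem norm_reVec_le (z c : ℂ) :
    ‖reVec β z c‖ ≤ ‖LinearMap.toContinuousLinearMap (reVec β z)‖ * ‖c‖ :=
  (LinearMap.toContinuousLinearMap (reVec β z)).le_opNorm c

theorem Phi_add (hβ : IsIntegral ℤ β) {x y : ℝ}
    (hx : x ∈ Algebra.adjoin ℤ {β}) (hy : y ∈ Algebra.adjoin ℤ {β}) :
    Phi β (x + y) = Phi β x + Phi β y := by
  apply Subtype.ext
  rw [Submodule.coe_add, coe_Phi, coe_Phi, coe_Phi, ← Finset.sum_add_distrib]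
  refine Finset.sum_congr rfl fun z hz => ?_
  rw [gal_add hβ (Finset.mem_of_mem_erase hz) hx hy, map_add]

theorem Phi_zero (hβ : IsIntegral ℤ β) : Phi β 0 = 0 := by
  have := Phi_add hβ (zero_mem (Algebra.adjoin ℤ {β})) (zero_mem _)
  simpa using this

theorem Phi_neg (hβ : IsIntegral ℤ β) {x : ℝ}
    (hx : x ∈ Algebra.adjoin ℤ {β}) : Phi β (-x) = -Phi β x := by
  have := Phi_add hβ hx (neg_mem hx)
  rw [add_neg_cancel, Phi_zero hβ] at this
  exact (neg_eq_of_add_eq_zero_right this.symm).symm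

theorem Phi_sum (hβ : IsIntegral ℤ β) (f : ℕ → ℝ)
    (hf : ∀ n, f n ∈ Algebra.adjoin ℤ {β}) (n : ℕ) :
    Phi β (∑ k ∈ Finset.range n, f k) = ∑ k ∈ Finset.range n, Phi β (f k) := by
  induction n with
  | zero => simp [Phi_zero hβ]
  | succ n ih =>
    rw [Finset.sum_range_succ, Phi_add hβ (sum_mem fun k _ => hf k) (hf n), ih,
      Finset.sum_range_succ]

theorem exists_rate (hβ : IsPisotUnit β) :
    ∃ ρ : ℝ, 0 < ρ ∧ ρ < 1 ∧ ∀ z ∈ (conjugates β).erase (β : ℂ), ‖z‖ ≤ ρ := by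
  have h : ∀ s : Finset ℂ, (∀ z ∈ s, ‖z‖ < 1) →
      ∃ ρ : ℝ, 0 < ρ ∧ ρ < 1 ∧ ∀ z ∈ s, ‖z‖ ≤ ρ := by
    intro s
    induction s using Finset.induction_on with
    | empty => exact fun _ => ⟨1 / 2, by norm_num, by norm_num, by simp⟩
    | insert a s _ ih =>
      intro h
      obtain ⟨ρ, h0, h1, h2⟩ := ih fun z hz => h z (Finset.mem_insert_of_mem hz)
      refine ⟨max ρ ‖a‖, lt_max_of_lt_left h0, max_lt h1 (h a (Finset.mem_insert_self _ _)), ?_⟩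
      intro z hz
      rcases Finset.mem_insert.1 hz with rfl | hz
      · exact le_max_right _ _
      · exact (h2 z hz).trans (le_max_left _ _)
  refine h _ fun z hz => hβ.2.2.2 z ?_ (Finset.ne_of_mem_erase hz)
  exact (mem_conjugates hβ.2.1).1 (Finset.mem_of_mem_erase hz)

theorem norm_Phi_mul_pow_le (hβ : IsPisotUnit β) {ρ : ℝ}
    (hρ : ∀ z ∈ (conjugates β).erase (β : ℂ), ‖z‖ ≤ ρ) {x : ℝ}
    (hx : x ∈ Algebra.adjoin ℤ {β}) : ∃ C, ∀ n : ℕ, ‖Phi β (x * β ^ n)‖ ≤ C * ρ ^ n := by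
  refine ⟨∑ z ∈ (conjugates β).erase (β : ℂ),
    ‖LinearMap.toContinuousLinearMap (reVec β z)‖ * ‖gal β z x‖, fun n => ?_⟩
  change ‖(Phi β (x * β ^ n) : Space β)‖ ≤ _
  rw [coe_Phi, Finset.sum_mul]
  refine (norm_sum_le _ _).trans (Finset.sum_le_sum fun z hz => (norm_reVec_le _ _).trans ?_)
  rw [gal_mul_pow hβ.2.1 (Finset.mem_of_mem_erase hz) hx, norm_mul, norm_pow, mul_assoc]
  gcongr
  exact hρ z hz

theorem exists_Phi_bound (hβ : IsPisotUnit β) (A : Finset ℝ)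
    (hA : ∀ a ∈ A, a ∈ Algebra.adjoin ℤ {β}) :
    ∃ C ρ : ℝ, 0 < C ∧ 0 < ρ ∧ ρ < 1 ∧ ∀ a ∈ A, ∀ n : ℕ, ‖Phi β (a * β ^ n)‖ ≤ C * ρ ^ n := by
  obtain ⟨ρ, h0, h1, hρ⟩ := exists_rate hβ
  induction A using Finset.induction_on with
  | empty => exact ⟨1, ρ, one_pos, h0, h1, by simp⟩
  | insert a s _ ih =>
    obtain ⟨C, ρ', hC, h0', h1', h⟩ := ih fun z hz => hA z (Finset.mem_insert_of_mem hz)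
    obtain ⟨C', h'⟩ := norm_Phi_mul_pow_le hβ hρ (hA a (Finset.mem_insert_self _ _))
    refine ⟨max C C', max ρ ρ', lt_max_of_lt_left hC, lt_max_of_lt_left h0, max_lt h1 h1', ?_⟩
    intro b hb n
    have hm : 0 ≤ max C C' := hC.le.trans (le_max_left _ _)
    rcases Finset.mem_insert.1 hb with rfl | hb
    · exact (h' n).trans (mul_le_mul (le_max_right _ _)
        (pow_le_pow_left₀ h0.le (le_max_left _ _) _) (pow_nonneg h0.le _) hm)
    · exact (h b hb n).trans (mul_le_mul (le_max_left _ _)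
        (pow_le_pow_left₀ h0'.le (le_max_right _ _) _) (pow_nonneg h0'.le _) hm)

end Vectors

/-! ### The companion matrix as a linear map -/

/-- The linear map `y ↦ M_β y`. -/
def compLin (β : ℝ) : Space β →ₗ[ℝ] Space β := Matrix.toEuclideanLin (companion β)

section Companion

variable {β : ℝ}

theorem compLin_apply (y : Space β) (i : Fin (deg β)) :
    compLin β y i = ∑ j, companion β i j * y j := rfl

theorem compLin_reVec (hβ : IsIntegral ℤ β) {z : ℂ} (hz : z ∈ conjugates β) (c : ℂ) :
    compLin β (reVec β z c) = reVec β z (z * c) := by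
  ext i
  have h := congrFun (companion_mulVec_eigvec hβ ((mem_conjugates hβ).1 hz)) i
  simp only [Matrix.mulVec, dotProduct, Matrix.map_apply, Pi.smul_apply, smul_eq_mul] at h
  rw [compLin_apply, reVec_apply, mul_comm z c, mul_assoc, ← h, Finset.mul_sum, Complex.re_sum]
  refine Finset.sum_congr rfl fun j _ => ?_
  rw [reVec_apply, mul_left_comm, ← Complex.re_ofReal_mul]
  rfl

theorem compLin_mem_hyperplane (hβ : IsIntegral ℤ β) {y : Space β} (hy : y ∈ hyperplane β) :
    compLin β y ∈ hyperplane β := by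
  refine hyperplane_induction (p := fun y => compLin β y ∈ hyperplane β) ?_ ?_ ?_ ?_ hy
  · intro z hz c
    rw [compLin_reVec hβ (Finset.mem_of_mem_erase hz)]
    exact reVec_mem_hyperplane hz _
  · simp
  · intro x y _ _ hx hy
    rw [map_add]; exact add_mem hx hy
  · intro a x _ hx
    rw [map_smul]; exact Submodule.smul_mem _ _ hx

theorem compLin_pow_reVec (hβ : IsIntegral ℤ β) {z : ℂ} (hz : z ∈ conjugates β) (c : ℂ) (n : ℕ) :
    (compLin β ^ n) (reVec β z c) = reVec β z (z ^ n * c) := by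
  induction n with
  | zero => simp
  | succ n ih => rw [pow_succ', Module.End.mul_apply, ih, compLin_reVec hβ hz, pow_succ', mul_assoc]

theorem tendsto_compLin_pow (hβ : IsPisotUnit β) {y : Space β} (hy : y ∈ hyperplane β) :
    Filter.Tendsto (fun n : ℕ => (compLin β ^ n) y) Filter.atTop (𝓝 0) := by
  refine hyperplane_induction
    (p := fun y => Filter.Tendsto (fun n : ℕ => (compLin β ^ n) y) Filter.atTop (𝓝 0)) ?_ ?_ ?_ ?_ hy
  · intro z hz c
    have hzc := Finset.mem_of_mem_erase hz
    have hlt : ‖z‖ < 1 :=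
      hβ.2.2.2 z ((mem_conjugates hβ.2.1).1 hzc) (Finset.ne_of_mem_erase hz)
    simp only [compLin_pow_reVec hβ.2.1 hzc]
    have h1 : Filter.Tendsto (fun n : ℕ => z ^ n * c) Filter.atTop (𝓝 0) := by
      simpa using (tendsto_pow_atTop_nhds_zero_of_norm_lt_one hlt).mul_const c
    have h2 := ((LinearMap.toContinuousLinearMap (reVec β z)).continuous.tendsto 0).comp h1
    simpa [Function.comp_def] using h2
  · simp
  · intro x y _ _ hx hy
    simpa using hx.add hy
  · intro a x _ hx
    simpa using hx.const_smul a

/-- The last coordinate is `1 / f'(β)`, and `f'(β) ≠ 0` by separability. -/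
theorem v1_ne_zero (hβ : IsIntegral ℤ β) : v1 β ≠ 0 := by
  intro h
  have hd : 0 < deg β := minpoly.natDegree_pos hβ
  have hE : eigvecRe β (β : ℂ) ⟨deg β - 1, by omega⟩ = 0 := by
    change v1 β _ = 0
    rw [h]; rfl
  simp only [eigvecRe, eigvec] at hE
  have h3 : aeval (β : ℂ) (derivative (minpoly ℤ β)) =
      ((aeval β (derivative (minpoly ℤ β)) : ℝ) : ℂ) :=
    aeval_algebraMap_apply ℂ β (derivative (minpoly ℤ β))
  rw [h3] at hE
  have h4 : aeval β (derivative (minpoly ℤ β)) ≠ 0 := by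
    have hs := (minpoly.irreducible (hβ.tower_top (A := ℚ))).separable
    have := hs.aeval_derivative_ne_zero (minpoly.aeval ℚ β)
    rwa [minpoly.isIntegrallyClosed_eq_field_fractions' ℚ hβ, derivative_map,
      aeval_map_algebraMap] at this
  simp only [← Complex.ofReal_inv, Nat.sub_self, pow_zero, mul_one, Complex.ofReal_re] at hE
  exact inv_ne_zero h4 hE

/-- The powers of `M_β` contract every vector of `H` to `0`, but multiply `v_1` by `β^n`. -/
theorem v1_notMem_hyperplane (hβ : IsPisotUnit β) : v1 β ∉ hyperplane β := by
  intro h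
  have h1 := (tendsto_compLin_pow hβ h).norm
  have h2 : ∀ n : ℕ, (compLin β ^ n) (v1 β) = β ^ n • v1 β := fun n => by
    have := compLin_pow_reVec hβ.2.1 (ofReal_mem_conjugates hβ.2.1) ((1 : ℝ) : ℂ) n
    rw [← Complex.ofReal_pow, ← Complex.ofReal_mul, reVec_ofReal, reVec_ofReal] at this
    simpa using this
  simp only [h2, norm_zero] at h1
  have h3 : 0 < ‖v1 β‖ := norm_pos_iff.2 (v1_ne_zero hβ.2.1)
  obtain ⟨n, hn⟩ := (h1.eventually_lt_const h3).exists
  rw [norm_smul, norm_pow, Real.norm_of_nonneg (by linarith [hβ.1])] at hn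
  nlinarith [one_le_pow₀ hβ.1.le (n := n)]

/-! ### The lattice `ℤ^d` as an image of `ℤ[β]` -/

/-- The map `x ↦ x v_1 + Φ(x)`, which sends `ℤ[β]` onto `ℤ^d`. -/
def embed (β : ℝ) (x : ℝ) : Space β := x • v1 β + Phi β x

/-- The integer vector `n` as an element of `ℝ^d`. -/
def intVec (β : ℝ) (n : Fin (deg β) → ℤ) : Space β := WithLp.toLp 2 fun i => (n i : ℝ)

theorem embed_eq_sum (hβ : IsIntegral ℤ β) {x : ℝ} (hx : x ∈ Algebra.adjoin ℤ {β}) :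
    embed β x = ∑ z ∈ conjugates β, reVec β z (gal β z x) := by
  rw [← Finset.add_sum_erase _ _ (ofReal_mem_conjugates hβ), gal_ofReal hβ hx, reVec_ofReal,
    ← coe_Phi]
  rfl

theorem embed_add (hβ : IsIntegral ℤ β) {x y : ℝ}
    (hx : x ∈ Algebra.adjoin ℤ {β}) (hy : y ∈ Algebra.adjoin ℤ {β}) :
    embed β (x + y) = embed β x + embed β y := by
  rw [embed, embed, embed, Phi_add hβ hx hy, add_smul, Submodule.coe_add]
  abel

theorem embed_zero (hβ : IsIntegral ℤ β) : embed β 0 = 0 := by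
  rw [embed, Phi_zero hβ]; simp

theorem embed_neg (hβ : IsIntegral ℤ β) {x : ℝ} (hx : x ∈ Algebra.adjoin ℤ {β}) :
    embed β (-x) = -embed β x := by
  rw [embed, embed, Phi_neg hβ hx, neg_smul, Submodule.coe_neg]
  abel

theorem compLin_embed (hβ : IsIntegral ℤ β) {x : ℝ} (hx : x ∈ Algebra.adjoin ℤ {β}) :
    compLin β (embed β x) = embed β (β * x) := by
  rw [embed_eq_sum hβ hx, embed_eq_sum hβ (mul_mem self_mem_adjoin hx), map_sum]
  refine Finset.sum_congr rfl fun z hz => ?_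
  rw [compLin_reVec hβ hz, gal_mul hβ hz self_mem_adjoin hx, gal_self hβ hz]

theorem compLin_Phi (hβ : IsIntegral ℤ β) {x : ℝ} (hx : x ∈ Algebra.adjoin ℤ {β}) :
    compLin β (Phi β x) = Phi β (β * x) := by
  rw [coe_Phi, coe_Phi, map_sum]
  refine Finset.sum_congr rfl fun z hz => ?_
  have hz' := Finset.mem_of_mem_erase hz
  rw [compLin_reVec hβ hz', gal_mul hβ hz' self_mem_adjoin hx, gal_self hβ hz']

theorem embed_one (hβ : IsIntegral ℤ β) (i : Fin (deg β)) :
    embed β 1 i = if (i : ℕ) = 0 then 1 else 0 := by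
  have h : embed β 1 i = (∑ z ∈ conjugates β, eigvec β z i).re := by
    rw [embed_eq_sum hβ (one_mem _), WithLp.ofLp_sum, Finset.sum_apply, Complex.re_sum]
    refine Finset.sum_congr rfl fun z hz => ?_
    rw [reVec_apply, gal_one hβ hz, one_mul]
  rw [h, sum_eigvec hβ i]
  split_ifs <;> simp

/-- The number `1` goes to `e_1`, and multiplication by `β` becomes the integer matrix `M_β`; so all
powers of `β`, and their integer combinations, land in `ℤ^d`. -/
theorem exists_intVec_eq_embed (hβ : IsIntegral ℤ β) {x : ℝ} (hx : x ∈ Algebra.adjoin ℤ {β}) :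
    ∃ n, embed β x = intVec β n := by
  rw [Algebra.adjoin_singleton_eq_range_aeval] at hx
  obtain ⟨p, rfl⟩ := hx
  have hmem : ∀ p : ℤ[X], aeval β p ∈ Algebra.adjoin ℤ {β} := fun p => by
    rw [Algebra.adjoin_singleton_eq_range_aeval]; exact ⟨p, rfl⟩
  have hint : ∀ k : ℕ, ∃ n, embed β (β ^ k) = intVec β n := by
    intro k
    induction k with
    | zero =>
      refine ⟨fun i => if (i : ℕ) = 0 then 1 else 0, ?_⟩
      ext i
      rw [pow_zero, embed_one hβ, intVec]
      simp
    | succ k ih =>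
      obtain ⟨n, hn⟩ := ih
      refine ⟨fun i => ∑ j : Fin (deg β), (if (i : ℕ) = 0 then -((minpoly ℤ β).coeff (deg β - 1 - j))
        else if (i : ℕ) = j + 1 then 1 else 0) * n j, ?_⟩
      ext i
      rw [pow_succ', ← compLin_embed hβ (pow_mem self_mem_adjoin k), hn, compLin_apply, intVec,
        intVec]
      push_cast
      rfl
  have hint' : ∀ p : ℤ[X], ∃ n, embed β (aeval β p) = intVec β n := by
    intro p
    induction p using Polynomial.induction_on' with
    | add p q hp hq =>
      obtain ⟨n, hn⟩ := hp
      obtain ⟨m, hm⟩ := hq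
      refine ⟨n + m, ?_⟩
      rw [map_add, embed_add hβ (hmem p) (hmem q), hn, hm]
      ext i
      simp [intVec]
    | monomial k a =>
      obtain ⟨n, hn⟩ := hint k
      rw [aeval_monomial]
      have hk : β ^ k ∈ Algebra.adjoin ℤ {β} := pow_mem self_mem_adjoin k
      have hnat : ∀ m : ℕ, embed β (m * β ^ k) = intVec β (m • n) := by
        intro m
        induction m with
        | zero => ext i; simp [embed_zero hβ, intVec]
        | succ m ih =>
          have : ((m + 1 : ℕ) : ℝ) * β ^ k = m * β ^ k + β ^ k := by push_cast; ring
          rw [this, embed_add hβ (mul_mem (natCast_mem _ m) hk) hk, ih, hn]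
          ext i
          simp [intVec]
          ring
      obtain ⟨m, rfl | rfl⟩ := a.eq_nat_or_neg
      · exact ⟨m • n, by simpa using hnat m⟩
      · refine ⟨-(m • n), ?_⟩
        have : (algebraMap ℤ ℝ) (-(m : ℤ)) * β ^ k = -(m * β ^ k) := by simp
        rw [this, embed_neg hβ (mul_mem (natCast_mem _ m) hk), hnat]
        ext i
        simp [intVec]
  exact hint' p

theorem exists_embed_eq_intVec (hβ : IsIntegral ℤ β) (n : Fin (deg β) → ℤ) :
    ∃ x ∈ Algebra.adjoin ℤ {β}, embed β x = intVec β n := by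
  have hd : 0 < deg β := minpoly.natDegree_pos hβ
  have hbasis : ∀ k (hk : k < deg β), ∃ x ∈ Algebra.adjoin ℤ {β},
      embed β x = intVec β (Pi.single ⟨k, hk⟩ 1) := by
    intro k
    induction k with
    | zero =>
      intro hk
      refine ⟨1, one_mem _, ?_⟩
      ext i
      rw [embed_one hβ, intVec]
      simp [Pi.single_apply, Fin.ext_iff]
    | succ k ih =>
      intro hk
      obtain ⟨x, hx, hxe⟩ := ih (by omega)
      -- Column `k` of `M_β` is `e_{k+1}` minus this coefficient times `e_0` (indices from `0`);
      -- adding the coefficient back leaves `e_{k+1}`.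
      refine ⟨β * x + ((minpoly ℤ β).coeff (deg β - 1 - k) : ℝ), add_mem
        (mul_mem self_mem_adjoin hx) (intCast_mem _ _), ?_⟩
      have hz : ∀ a : ℤ, embed β (a : ℝ) = (a : ℝ) • embed β 1 := by
        intro a
        let g : ℤ →+ Space β :=
          { toFun := fun a => embed β (a : ℝ)
            map_zero' := by simp [embed_zero hβ]
            map_add' := fun a b => by
              rw [Int.cast_add, embed_add hβ (intCast_mem _ _) (intCast_mem _ _)] }
        have := map_zsmul g a 1
        simp only [smul_eq_mul, mul_one] at this
        rw [Int.cast_smul_eq_zsmul]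
        simpa [g] using this
      rw [embed_add hβ (mul_mem self_mem_adjoin hx) (intCast_mem _ _),
        ← compLin_embed hβ hx, hxe, hz]
      ext i
      rw [PiLp.add_apply, PiLp.smul_apply, compLin_apply, embed_one hβ,
        Finset.sum_eq_single (⟨k, by omega⟩ : Fin (deg β))]
      · simp only [intVec, companion, Pi.single_apply, Fin.ext_iff]
        by_cases hi : (i : ℕ) = 0 <;> by_cases hi' : (i : ℕ) = k + 1 <;> simp [hi, hi']
      · intro j _ hj
        simp [intVec, hj]
      · simp
  choose! f hf using hbasis
  refine ⟨∑ i : Fin (deg β), (n i : ℝ) * f i, sum_mem fun i _ =>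
    mul_mem (intCast_mem _ _) (hf i i.2).1, ?_⟩
  let A := Algebra.adjoin ℤ {β}
  let g : A →+ Space β :=
    { toFun := fun a => embed β (a : ℝ)
      map_zero' := by simp [embed_zero hβ]
      map_add' := fun a b => embed_add hβ a.2 b.2 }
  have h1 : ((∑ i : Fin (deg β), n i • (⟨f i, (hf i i.2).1⟩ : A) : A) : ℝ) =
      ∑ i : Fin (deg β), (n i : ℝ) * f i := by
    simp
  have h2 : g (∑ i : Fin (deg β), n i • (⟨f i, (hf i i.2).1⟩ : A)) =
      ∑ i : Fin (deg β), n i • intVec β (Pi.single i 1) := by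
    rw [map_sum]
    refine Finset.sum_congr rfl fun i _ => ?_
    rw [map_zsmul]
    congr 1
    exact (hf i i.2).2
  rw [← h1]
  change g _ = _
  rw [h2]
  ext i
  simp [intVec, Pi.single_apply]

end Companion

/-! ### The splitting of `ℝ^d` into the line of `v_1` and the hyperplane `H` -/

section Coordinates

variable {β : ℝ}

/-- The linear map `(x, h) ↦ x v_1 + h`. -/
def coordMap (β : ℝ) : ℝ × hyperplane β →ₗ[ℝ] Space β :=
  (LinearMap.toSpanSingleton ℝ (Space β) (v1 β)).coprod (hyperplane β).subtype

theorem coordMap_apply (x : ℝ) (h : hyperplane β) : coordMap β (x, h) = x • v1 β + h := by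
  simp [coordMap]

theorem eq_zero_of_smul_v1_mem (hβ : IsPisotUnit β) {x : ℝ} (hx : x • v1 β ∈ hyperplane β) :
    x = 0 := by
  by_contra h
  exact v1_notMem_hyperplane hβ ((Submodule.smul_mem_iff _ h).1 hx)

theorem coordMap_injective (hβ : IsPisotUnit β) : Function.Injective (coordMap β) := by
  rw [injective_iff_map_eq_zero]
  rintro ⟨x, h⟩ hx
  rw [coordMap_apply] at hx
  have h0 : x = 0 := eq_zero_of_smul_v1_mem hβ (by
    rw [eq_neg_of_add_eq_zero_left hx]; exact neg_mem h.2)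
  subst h0
  rw [zero_smul, zero_add] at hx
  exact Prod.ext rfl (Subtype.ext hx)

theorem coordMap_surjective (hβ : IsPisotUnit β) : Function.Surjective (coordMap β) := by
  have hint : ∀ n, intVec β n ∈ LinearMap.range (coordMap β) := fun n => by
    obtain ⟨x, _, hx⟩ := exists_embed_eq_intVec hβ.2.1 n
    exact ⟨(x, Phi β x), by rw [coordMap_apply, ← hx, embed]⟩
  rw [← LinearMap.range_eq_top, eq_top_iff]
  intro y _
  have : y = ∑ i, y i • intVec β (Pi.single i 1) := by
    ext j
    simp [intVec, Pi.single_apply]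
  rw [this]
  exact sum_mem fun i _ => Submodule.smul_mem _ _ (hint _)

/-- The isomorphism `ℝ × H ≃ ℝ^d`, `(x, h) ↦ x v_1 + h`. -/
def coordEquiv (hβ : IsPisotUnit β) : (ℝ × hyperplane β) ≃L[ℝ] Space β :=
  (LinearEquiv.ofBijective (coordMap β)
    ⟨coordMap_injective hβ, coordMap_surjective hβ⟩).toContinuousLinearEquiv

theorem coordEquiv_apply (hβ : IsPisotUnit β) (x : ℝ) (h : hyperplane β) :
    coordEquiv hβ (x, h) = x • v1 β + h := coordMap_apply x h

theorem coordEquiv_Phi (hβ : IsPisotUnit β) (x : ℝ) :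
    coordEquiv hβ (x, Phi β x) = embed β x := coordMap_apply _ _

theorem proj1_smul_add (hβ : IsPisotUnit β) (x : ℝ) {h : Space β} (hh : h ∈ hyperplane β) :
    proj1 β (x • v1 β + h) = x := by
  have hex : ∃ t : ℝ, (x • v1 β + h) - t • v1 β ∈ hyperplane β := ⟨x, by simpa using hh⟩
  rw [proj1, dif_pos hex]
  have h1 : (x - hex.choose) • v1 β ∈ hyperplane β := by
    have := sub_mem hex.choose_spec hh
    have e : (x - hex.choose) • v1 β = x • v1 β + h - hex.choose • v1 β - h := by
      rw [sub_smul]; abel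
    rwa [e]
  linarith [eq_zero_of_smul_v1_mem hβ h1]

theorem proj1_eq (hβ : IsPisotUnit β) (y : Space β) :
    proj1 β y = ((coordEquiv hβ).symm y).1 := by
  obtain ⟨⟨x, h⟩, rfl⟩ := (coordEquiv hβ).surjective y
  rw [ContinuousLinearEquiv.symm_apply_apply, coordEquiv_apply, proj1_smul_add hβ _ h.2]

theorem finite_intVec_norm_le (R : ℝ) : {n : Fin (deg β) → ℤ | ‖intVec β n‖ ≤ R}.Finite := by
  refine (finite_Icc (fun _ => -⌈R⌉) (fun _ => ⌈R⌉)).subset fun n hn => ?_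
  have h : ∀ i, |(n i : ℝ)| ≤ ⌈R⌉ := fun i =>
    ((PiLp.norm_apply_le (intVec β n) i).trans hn).trans (Int.le_ceil R)
  refine ⟨fun i => ?_, fun i => ?_⟩
  · exact_mod_cast (abs_le.1 (h i)).1
  · exact_mod_cast (abs_le.1 (h i)).2

theorem embed_injective (hβ : IsPisotUnit β) : Function.Injective (embed β) := by
  intro x y h
  rw [← coordEquiv_Phi hβ, ← coordEquiv_Phi hβ] at h
  exact congrArg Prod.fst ((coordEquiv hβ).injective h)

theorem intVec_injective : Function.Injective (intVec β) := by
  intro n m h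
  funext i
  have : (n i : ℝ) = m i := congrFun (congrArg WithLp.ofLp h) i
  exact_mod_cast this

/-- Bounds on both coordinates confine the lattice point `x v_1 + Φ(x)` to a ball. This discreteness
gives local finiteness of the tiles in `H` and limits the indices relevant to a bounded covering. -/
theorem finite_adjoin_bounded (hβ : IsPisotUnit β) (R R' : ℝ) :
    {x | x ∈ Algebra.adjoin ℤ {β} ∧ |x| ≤ R ∧ ‖Phi β x‖ ≤ R'}.Finite := by
  refine Finite.of_finite_image (f := embed β) ?_ (embed_injective hβ).injOn
  refine ((finite_intVec_norm_le (β := β) (R * ‖v1 β‖ + R')).image (intVec β)).subset ?_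
  rintro _ ⟨x, ⟨hx, h1, h2⟩, rfl⟩
  obtain ⟨n, hn⟩ := exists_intVec_eq_embed hβ.2.1 hx
  refine ⟨n, ?_, hn.symm⟩
  change ‖intVec β n‖ ≤ _
  rw [← hn, embed]
  refine (norm_add_le _ _).trans (add_le_add ?_ h2)
  rw [norm_smul]
  exact mul_le_mul_of_nonneg_right h1 (norm_nonneg _)

/-- An integer `m > 1` has the minimal polynomial `X - m`, whose constant coefficient is not `± 1`.
So the fractional part of `β` lies in `(0, 1)`, and its powers are arbitrarily small positive
elements. -/
theorem dense_adjoin (hβ : IsPisotUnit β) : Dense (Algebra.adjoin ℤ {β} : Set ℝ) := by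
  have hne : ∀ m : ℤ, (m : ℝ) ≠ β := by
    rintro m rfl
    have h := hβ.2.2.1
    have h2 : minpoly ℤ (m : ℝ) = X - C m := minpoly.eq_X_sub_C_of_algebraMap_inj m
      (FaithfulSMul.algebraMap_injective ℤ ℝ)
    rw [h2] at h
    simp only [coeff_sub, coeff_X_zero, coeff_C_zero, zero_sub, abs_neg] at h
    have h3 : (1 : ℤ) < m := by exact_mod_cast hβ.1
    rw [abs_of_pos (by omega)] at h
    omega
  refine AddSubgroup.dense_of_not_isolated_zero
    (Subalgebra.toSubmodule (Algebra.adjoin ℤ {β})).toAddSubgroup fun ε hε => ?_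
  have h0 : 0 < Int.fract β := by
    rw [Int.fract_pos]
    exact fun h => hne _ h.symm
  obtain ⟨n, hn⟩ := exists_pow_lt_of_lt_one hε (Int.fract_lt_one β)
  refine ⟨Int.fract β ^ n, ?_, pow_pos h0 n, hn⟩
  change _ ∈ Algebra.adjoin ℤ {β}
  exact pow_mem (sub_mem self_mem_adjoin (intCast_mem _ _)) n

/-- The restriction of `M_β` to the hyperplane `H`. -/
def shiftH (hβ : IsPisotUnit β) : hyperplane β →ₗ[ℝ] hyperplane β :=
  (compLin β).restrict fun _ hy => compLin_mem_hyperplane hβ.2.1 hy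

theorem shiftH_Phi (hβ : IsPisotUnit β) {x : ℝ} (hx : x ∈ Algebra.adjoin ℤ {β}) :
    shiftH hβ (Phi β x) = Phi β (β * x) := Subtype.ext (compLin_Phi hβ.2.1 hx)

/-- This is where the unit condition enters: the constant coefficient is nonzero, so no conjugate
vanishes and division by `z` is possible. -/
theorem shiftH_surjective (hβ : IsPisotUnit β) : Function.Surjective (shiftH hβ) := by
  rintro ⟨y, hy⟩
  suffices h : ∃ w ∈ hyperplane β, compLin β w = y by
    obtain ⟨w, hw, rfl⟩ := h
    exact ⟨⟨w, hw⟩, rfl⟩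
  refine hyperplane_induction (p := fun y => ∃ w ∈ hyperplane β, compLin β w = y) ?_ ?_ ?_ ?_ hy
  · intro z hz c
    have hzc := Finset.mem_of_mem_erase hz
    have hz0 : z ≠ 0 := by
      rintro rfl
      have h := (mem_conjugates hβ.2.1).1 hzc
      have h1 := hβ.2.2.1
      have h2 : ((minpoly ℤ β).coeff 0 : ℂ) = 0 := by
        rw [← h]; simp [aeval_def, eval₂_at_zero]
      rw [Int.cast_eq_zero] at h2
      rw [h2] at h1
      simp at h1
    refine ⟨reVec β z (z⁻¹ * c), reVec_mem_hyperplane hz _, ?_⟩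
    rw [compLin_reVec hβ.2.1 hzc, mul_inv_cancel_left₀ hz0]
  · exact ⟨0, zero_mem _, map_zero _⟩
  · rintro x y _ _ ⟨a, ha, rfl⟩ ⟨b, hb, rfl⟩
    exact ⟨a + b, add_mem ha hb, map_add _ _ _⟩
  · rintro a x _ ⟨b, hb, rfl⟩
    exact ⟨a • b, Submodule.smul_mem _ _ hb, map_smul _ _ _⟩

theorem isOpenMap_shiftH (hβ : IsPisotUnit β) : IsOpenMap (shiftH hβ) :=
  LinearMap.isOpenMap_of_finiteDimensional _ (shiftH_surjective hβ)

end Coordinates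

/-! ### Surjective piecewise affine maps -/

/-- The union of the pieces `P a`, `a ∈ A`. -/
def domain (A : Finset ℝ) (P : ℝ → Set ℝ) : Set ℝ := ⋃ a ∈ A, P a

/-- The map `x ↦ β x - a` on `P a`, `a ∈ A`. -/
def stepMap (β : ℝ) (A : Finset ℝ) (P : ℝ → Set ℝ) (x : ℝ) : ℝ := β * x - digitOf A P x

/-- The pieces `P a`, `a ∈ A ⊂ ℤ[β]`, are pairwise disjoint and `stepMap` sends their union onto
itself. -/
structure IsBranchSystem (β : ℝ) (A : Finset ℝ) (P : ℝ → Set ℝ) : Prop where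
  mem_adjoin : ∀ a ∈ A, a ∈ Algebra.adjoin ℤ {β}
  eq_of_mem : ∀ a ∈ A, ∀ a' ∈ A, ∀ x, x ∈ P a → x ∈ P a' → a = a'
  maps : ∀ a ∈ A, ∀ x ∈ P a, β * x - a ∈ domain A P
  surj : ∀ y ∈ domain A P, ∃ a ∈ A, ∃ x ∈ P a, β * x - a = y

/-- `y` is a backward orbit of `x` along the digits `w`. -/
def IsChain (β : ℝ) (A : Finset ℝ) (P : ℝ → Set ℝ) (x : ℝ) (w y : ℕ → ℝ) : Prop :=
  y 0 = x ∧ ∀ n, w n ∈ A ∧ y (n + 1) ∈ P (w n) ∧ β * y (n + 1) - w n = y n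

/-- The image under `φ` of the set of left-infinite digit sequences of backward orbits of `x`. -/
def fiber (β : ℝ) (A : Finset ℝ) (P : ℝ → Set ℝ) (x : ℝ) : Set (hyperplane β) :=
  phi β '' {w | ∃ y, IsChain β A P x w y}

/-- The numbers `β^n z - x`, where `z` runs through the preimages of order `n` of `x`. -/
def preSet (β : ℝ) (A : Finset ℝ) (P : ℝ → Set ℝ) (n : ℕ) (x : ℝ) : Set ℝ :=
  {s | ∃ z ∈ domain A P, (stepMap β A P)^[n] z = x ∧ s = β ^ n * z - x}

/-- A geometric bound for `Φ(a β^n)`, `a ∈ A`. -/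
structure PhiBound (β : ℝ) (A : Finset ℝ) (K ρ : ℝ) : Prop where
  pos : 0 < K
  rate_pos : 0 < ρ
  rate_lt_one : ρ < 1
  le : ∀ a ∈ A, ∀ n : ℕ, ‖Phi β (a * β ^ n)‖ ≤ K * (1 - ρ) * ρ ^ n

section Systems

variable {β : ℝ} {A : Finset ℝ} {P : ℝ → Set ℝ} {K ρ : ℝ}

/-- The factor `1 - ρ` is normalised into the bound so that the tails of `φ` from index `n` on are
at most `K ρ^n`. -/
theorem exists_phiBound (hβ : IsPisotUnit β) (hA : ∀ a ∈ A, a ∈ Algebra.adjoin ℤ {β}) :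
    ∃ K ρ, PhiBound β A K ρ := by
  obtain ⟨C, ρ, hC, h0, h1, h⟩ := exists_Phi_bound hβ A hA
  have h2 : 0 < 1 - ρ := sub_pos.2 h1
  refine ⟨C / (1 - ρ), ρ, div_pos hC h2, h0, h1, fun a ha n => ?_⟩
  rw [div_mul_cancel₀ _ h2.ne']
  exact h a ha n

theorem PhiBound.tendsto (hK : PhiBound β A K ρ) :
    Filter.Tendsto (fun n : ℕ => K * ρ ^ n) Filter.atTop (𝓝 0) := by
  simpa using (tendsto_pow_atTop_nhds_zero_of_lt_one hK.rate_pos.le hK.rate_lt_one).const_mul K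

theorem PhiBound.summable (hK : PhiBound β A K ρ) {w : ℕ → ℝ} (hw : ∀ n, w n ∈ A) :
    Summable fun n : ℕ => Phi β (w n * β ^ n) :=
  Summable.of_norm_bounded
    ((summable_geometric_of_lt_one hK.rate_pos.le hK.rate_lt_one).mul_left (K * (1 - ρ)))
    fun n => hK.le _ (hw n) n

theorem PhiBound.norm_sub_phi_le (hβ : IsPisotUnit β) (hK : PhiBound β A K ρ)
    (hA : ∀ a ∈ A, a ∈ Algebra.adjoin ℤ {β}) {w : ℕ → ℝ} (hw : ∀ n, w n ∈ A) (n : ℕ) :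
    ‖Phi β (∑ k ∈ Finset.range n, w k * β ^ k) - phi β w‖ ≤ K * ρ ^ n := by
  rw [Phi_sum hβ.2.1 _ fun k => mul_mem (hA _ (hw k)) (pow_mem self_mem_adjoin k)]
  have h := norm_sub_le_of_geometric_bound_of_hasSum hK.rate_lt_one
    (fun n => hK.le _ (hw n) n) (hK.summable hw).hasSum n
  have h2 : 1 - ρ ≠ 0 := (sub_pos.2 hK.rate_lt_one).ne'
  have h3 : K * (1 - ρ) * ρ ^ n / (1 - ρ) = K * ρ ^ n := by field_simp
  rwa [h3] at h

theorem PhiBound.continuousOn_phi (hK : PhiBound β A K ρ) :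
    ContinuousOn (phi β) (univ.pi fun _ => (A : Set ℝ)) := by
  refine continuousOn_tsum (u := fun n => K * (1 - ρ) * ρ ^ n) (fun n => ?_)
    ((summable_geometric_of_lt_one hK.rate_pos.le hK.rate_lt_one).mul_left _)
    fun n w hw => hK.le _ (hw n (mem_univ n)) n
  exact (A.finite_toSet.continuousOn (fun a : ℝ => Phi β (a * β ^ n))).comp
    (continuous_apply n).continuousOn fun w hw => hw n (mem_univ n)

theorem mem_domain {x : ℝ} : x ∈ domain A P ↔ ∃ a ∈ A, x ∈ P a := by
  simp [domain]

namespace IsBranchSystem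

variable (hS : IsBranchSystem β A P)
include hS

theorem digitOf_eq {a x : ℝ} (ha : a ∈ A) (hx : x ∈ P a) : digitOf A P x = a := by
  have h : ∃ a ∈ A, x ∈ P a := ⟨a, ha, hx⟩
  rw [digitOf, dif_pos h]
  exact hS.eq_of_mem _ h.choose_spec.1 _ ha _ h.choose_spec.2 hx

theorem stepMap_eq {a x : ℝ} (ha : a ∈ A) (hx : x ∈ P a) : stepMap β A P x = β * x - a := by
  rw [stepMap, hS.digitOf_eq ha hx]

theorem digitOf_mem {x : ℝ} (hx : x ∈ domain A P) : digitOf A P x ∈ A ∧ x ∈ P (digitOf A P x) := by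
  obtain ⟨a, ha, hxa⟩ := mem_domain.1 hx
  rw [hS.digitOf_eq ha hxa]
  exact ⟨ha, hxa⟩

theorem stepMap_mem {x : ℝ} (hx : x ∈ domain A P) : stepMap β A P x ∈ domain A P :=
  hS.maps _ (hS.digitOf_mem hx).1 _ (hS.digitOf_mem hx).2

theorem iterate_mem {x : ℝ} (hx : x ∈ domain A P) (n : ℕ) :
    (stepMap β A P)^[n] x ∈ domain A P := by
  induction n with
  | zero => exact hx
  | succ n ih => rw [Function.iterate_succ_apply']; exact hS.stepMap_mem ih

theorem chain_mem {x : ℝ} {w y : ℕ → ℝ} (h : IsChain β A P x w y) (n : ℕ) :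
    y n ∈ domain A P := by
  rw [← (h.2 n).2.2]
  exact hS.maps _ (h.2 n).1 _ (h.2 n).2.1

theorem iterate_chain {x : ℝ} {w y : ℕ → ℝ} (h : IsChain β A P x w y) (m n : ℕ) :
    (stepMap β A P)^[m] (y (n + m)) = y n := by
  induction m with
  | zero => rfl
  | succ m ih =>
    rw [Function.iterate_succ_apply, ← add_assoc, hS.stepMap_eq (h.2 _).1 (h.2 _).2.1,
      (h.2 _).2.2, ih]

omit hS in
theorem pow_mul_chain_sub {x : ℝ} {w y : ℕ → ℝ} (h : IsChain β A P x w y) (n : ℕ) :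
    β ^ n * y n - x = ∑ k ∈ Finset.range n, w k * β ^ k := by
  induction n with
  | zero => simp [h.1]
  | succ n ih =>
    rw [Finset.sum_range_succ, ← ih, ← (h.2 n).2.2]
    ring

theorem exists_chain {x : ℝ} (hx : x ∈ domain A P) : ∃ w y, IsChain β A P x w y := by
  choose! a ha f hf he using hS.surj
  have hmem : ∀ n, f^[n] x ∈ domain A P := by
    intro n
    induction n with
    | zero => exact hx
    | succ n ih =>
      rw [Function.iterate_succ_apply']
      exact mem_domain.2 ⟨_, ha _ ih, hf _ ih⟩
  refine ⟨fun n => a (f^[n] x), fun n => f^[n] x, rfl, fun n => ?_⟩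
  simp only [Function.iterate_succ_apply']
  exact ⟨ha _ (hmem n), hf _ (hmem n), he _ (hmem n)⟩

omit hS in
theorem chain_cons {a z : ℝ} (ha : a ∈ A) (hz : z ∈ P a) {w y : ℕ → ℝ}
    (h : IsChain β A P z w y) :
    IsChain β A P (β * z - a) (fun n => Nat.casesOn n a w)
      (fun n => Nat.casesOn n (β * z - a) y) := by
  refine ⟨rfl, fun n => ?_⟩
  cases n with
  | zero =>
    refine ⟨ha, ?_, ?_⟩
    · simpa [h.1] using hz
    · simp [h.1]
  | succ n => exact h.2 n

omit hS in
theorem chain_append {x : ℝ} {w y w' y' : ℕ → ℝ} (h : IsChain β A P x w y) (n : ℕ)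
    (h' : IsChain β A P (y n) w' y') :
    ∃ w'' y'', IsChain β A P x w'' y'' ∧ (∀ k < n, w'' k = w k) ∧ (∀ k, w'' (n + k) = w' k) ∧
      ∀ k, y'' (n + k) = y' k := by
  refine ⟨fun k => if k < n then w k else w' (k - n),
    fun k => if k < n then y k else y' (k - n), ⟨?_, fun k => ?_⟩, ?_, ?_, ?_⟩
  · by_cases hn : 0 < n
    · simp [hn, h.1]
    · obtain rfl : n = 0 := by omega
      simp [h'.1, h.1]
  · rcases lt_trichotomy (k + 1) n with hk | hk | hk
    · have h1 : k < n := by omega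
      simpa [hk, h1] using h.2 k
    · have h1 : k < n := by omega
      have h2 : ¬ k + 1 < n := by omega
      have h3 := h.2 k
      subst hk
      simpa [h'.1] using h3
    · have h1 : ¬ k < n := by omega
      have h2 : ¬ k + 1 < n := by omega
      have h3 : k + 1 - n = (k - n) + 1 := by omega
      simp only [h1, h2, if_false, h3]
      exact h'.2 (k - n)
  · intro k hk; simp [hk]
  · intro k; simp
  · intro k; simp

theorem exists_chain_through {x z : ℝ} (hz : z ∈ domain A P) {n : ℕ}
    (h : (stepMap β A P)^[n] z = x) : ∃ w y, IsChain β A P x w y ∧ y n = z := by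
  induction n generalizing x with
  | zero =>
    obtain ⟨w, y, hc⟩ := hS.exists_chain hz
    rw [← h]
    exact ⟨w, y, hc, hc.1⟩
  | succ n ih =>
    rw [Function.iterate_succ_apply'] at h
    obtain ⟨w, y, hc, hy⟩ := ih rfl
    have hm := hS.digitOf_mem (hS.iterate_mem hz n)
    have := chain_cons hm.1 hm.2 hc
    rw [← hS.stepMap_eq hm.1 hm.2, h] at this
    exact ⟨_, _, this, hy⟩

/-- Unfolding `y_k = β y_{k+1} - w_k` gives `β^n y_n - x = ∑_{k<n} w_k β^k`, so the left term is a
partial sum of the series `φ(w)`. -/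
theorem norm_sub_phi_le (hβ : IsPisotUnit β) (hK : PhiBound β A K ρ) {x : ℝ} {w y : ℕ → ℝ}
    (h : IsChain β A P x w y) (n : ℕ) :
    ‖Phi β (β ^ n * y n - x) - phi β w‖ ≤ K * ρ ^ n := by
  rw [pow_mul_chain_sub h]
  exact hK.norm_sub_phi_le hβ hS.mem_adjoin (fun n => (h.2 n).1) n

theorem exists_fiber_near (hβ : IsPisotUnit β) (hK : PhiBound β A K ρ) {x z : ℝ}
    (hz : z ∈ domain A P) {n : ℕ} (h : (stepMap β A P)^[n] z = x) :
    ∃ g ∈ fiber β A P x, ‖Phi β (β ^ n * z - x) - g‖ ≤ K * ρ ^ n := by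
  obtain ⟨w, y, hc, rfl⟩ := hS.exists_chain_through hz h
  exact ⟨phi β w, ⟨w, ⟨y, hc⟩, rfl⟩, hS.norm_sub_phi_le hβ hK hc n⟩

theorem fiber_nonempty {x : ℝ} (hx : x ∈ domain A P) : (fiber β A P x).Nonempty := by
  obtain ⟨w, y, hc⟩ := hS.exists_chain hx
  exact ⟨phi β w, w, ⟨y, hc⟩, rfl⟩

theorem norm_le_of_mem_fiber (hβ : IsPisotUnit β) (hK : PhiBound β A K ρ) {x : ℝ}
    {g : hyperplane β} (hg : g ∈ fiber β A P x) : ‖g‖ ≤ K := by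
  obtain ⟨w, ⟨y, hc⟩, rfl⟩ := hg
  have := hS.norm_sub_phi_le hβ hK hc 0
  rw [hc.1, pow_zero, one_mul, sub_self, Phi_zero hβ.2.1, zero_sub, norm_neg] at this
  simpa using this

omit hS in
theorem chain_congr (hβ : 1 < β) {x : ℝ} {w y w' y' : ℕ → ℝ} {n : ℕ}
    (h : y 0 = x) (h' : y' 0 = x) (hy : ∀ k < n, β * y (k + 1) - w k = y k)
    (hy' : ∀ k < n, β * y' (k + 1) - w' k = y' k) (hw : ∀ k < n, w k = w' k) : y n = y' n := by
  induction n with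
  | zero => rw [h, h']
  | succ n ih =>
    have h1 := ih (fun k hk => hy k (by omega)) (fun k hk => hy' k (by omega))
      (fun k hk => hw k (by omega))
    rw [← hy n (by omega), ← hy' n (by omega), hw n (by omega)] at h1
    exact mul_left_cancel₀ (by linarith : β ≠ 0) (sub_left_injective h1)

omit hS in
/-- Every digit sequence determines a backward affine orbit of `x`, regardless of the pieces. -/
theorem exists_backward (hβ : 1 < β) (x : ℝ) (w : ℕ → ℝ) :
    ∃ y : ℕ → ℝ, y 0 = x ∧ ∀ n, β * y (n + 1) - w n = y n := by
  refine ⟨fun n => Nat.rec x (fun k z => (z + w k) / β) n, rfl, fun n => ?_⟩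
  have : β ≠ 0 := by linarith
  field_simp
  ring

omit hS in
-- The pieces are not closed, but the orbit is determined by its digits through `y_{n+1} = (y_n +
-- w_n) / β`. The condition at step `n` therefore depends only on `w_0, …, w_n`, which take finitely
-- many values, and so is closed in the product topology.
theorem isCompact_chainWords (hβ : 1 < β) (x : ℝ) :
    IsCompact {w | ∃ y, IsChain β A P x w y} := by
  have hpi : IsCompact (univ.pi fun _ : ℕ => (A : Set ℝ)) :=
    isCompact_univ_pi fun _ => A.finite_toSet.isCompact
  let S : ℕ → Set (ℕ → ℝ) := fun n => {w | (∀ k, w k ∈ A) ∧ ∃ y : ℕ → ℝ, y 0 = x ∧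
    (∀ k ≤ n, β * y (k + 1) - w k = y k) ∧ y (n + 1) ∈ P (w n)}
  let r : (n : ℕ) → (ℕ → ℝ) → (Fin (n + 1) → ℝ) := fun n w k => w k
  have hfin : ∀ n, (r n '' S n).Finite := fun n => by
    refine (Set.Finite.pi' (t := fun _ : Fin (n + 1) => (A : Set ℝ))
      fun _ => A.finite_toSet).subset ?_
    rintro _ ⟨w, hw, rfl⟩ k
    exact hw.1 k
  have heq : {w | ∃ y, IsChain β A P x w y} =
      (univ.pi fun _ : ℕ => (A : Set ℝ)) ∩ ⋂ n, r n ⁻¹' (r n '' S n) := by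
    ext w
    constructor
    · rintro ⟨y, hy⟩
      refine ⟨fun k _ => (hy.2 k).1, mem_iInter.2 fun n => ⟨w, ⟨fun k => (hy.2 k).1, y, hy.1,
        fun k _ => (hy.2 k).2.2, (hy.2 n).2.1⟩, rfl⟩⟩
    · rintro ⟨hw, hr⟩
      obtain ⟨y, h0, hy⟩ := exists_backward hβ x w
      refine ⟨y, h0, fun n => ⟨hw n (mem_univ n), ?_, hy n⟩⟩
      obtain ⟨w', ⟨_, y', h0', hy', hP⟩, he⟩ := mem_iInter.1 hr n
      have hww : ∀ k < n + 1, w' k = w k := fun k hk => congrFun he ⟨k, hk⟩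
      have : y' (n + 1) = y (n + 1) := chain_congr hβ h0' h0 (fun k hk => hy' k (by omega))
        (fun k _ => hy k) hww
      rw [← this, ← hww n (by omega)]
      exact hP
  rw [heq]
  refine hpi.inter_right (isClosed_iInter fun n => (hfin n).isClosed.preimage ?_)
  exact continuous_pi fun k => continuous_apply _

omit hS in
theorem isCompact_fiber (hβ : 1 < β) (hK : PhiBound β A K ρ) (x : ℝ) :
    IsCompact (fiber β A P x) := by
  refine (isCompact_chainWords hβ x).image_of_continuousOn (hK.continuousOn_phi.mono ?_)
  rintro w ⟨y, hy⟩ k _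
  exact (hy.2 k).1

end IsBranchSystem

/-- The sets `preSet β A P n x`, `x ∈ ℝ`, are contained in a common finite set. -/
theorem exists_finite_preSet_subset (hS : IsBranchSystem β A P) (n : ℕ) :
    ∃ F : Set ℝ, F.Finite ∧ ∀ x, preSet β A P n x ⊆ F := by
  induction n with
  | zero =>
    refine ⟨{0}, finite_singleton 0, fun x => ?_⟩
    rintro s ⟨z, _, rfl, rfl⟩
    simp
  | succ n ih =>
    obtain ⟨F, hF, h⟩ := ih
    refine ⟨image2 (fun s a => β * s + a) F A, hF.image2 _ A.finite_toSet, fun x => ?_⟩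
    rintro s ⟨z, hz, hx, rfl⟩
    rw [Function.iterate_succ_apply', stepMap] at hx
    refine ⟨β ^ n * z - (stepMap β A P)^[n] z, h _ ⟨z, hz, rfl, rfl⟩, _,
      (hS.digitOf_mem (hS.iterate_mem hz n)).1, ?_⟩
    rw [← hx]
    ring

/-- Each point of either fiber is within `K ρ^n` of the image under `Φ` of the common finite set,
and vice versa. -/
theorem infDist_le_of_preSet_eq (hβ : IsPisotUnit β) (hK : PhiBound β A K ρ) {P' : ℝ → Set ℝ}
    (hS : IsBranchSystem β A P) (hS' : IsBranchSystem β A P') {n : ℕ} {t t' : ℝ}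
    (ht : t ∈ domain A P) (h : preSet β A P n t = preSet β A P' n t') (g : hyperplane β) :
    infDist g (fiber β A P' t') ≤ infDist g (fiber β A P t) + 2 * (K * ρ ^ n) := by
  obtain ⟨g₁, ⟨w, ⟨y, hc⟩, rfl⟩, hd⟩ :=
    (IsBranchSystem.isCompact_fiber (P := P) hβ.1 hK t).exists_infDist_eq_dist
      (hS.fiber_nonempty ht) g
  have h1 := hS.norm_sub_phi_le hβ hK hc n
  have hs : β ^ n * y n - t ∈ preSet β A P n t :=
    ⟨y n, hS.chain_mem hc n, by simpa [hc.1] using hS.iterate_chain hc n 0, rfl⟩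
  rw [h] at hs
  obtain ⟨z, hz, hzt, hzs⟩ := hs
  obtain ⟨g₂, hg₂, h2⟩ := hS'.exists_fiber_near hβ hK hz hzt
  rw [← hzs] at h2
  rw [hd]
  refine (infDist_le_dist_of_mem hg₂).trans ((dist_triangle g (phi β w) g₂).trans ?_)
  gcongr
  rw [dist_eq_norm]
  calc ‖phi β w - g₂‖ = ‖(Phi β (β ^ n * y n - t) - g₂) -
      (Phi β (β ^ n * y n - t) - phi β w)‖ := by congr 1; abel
    _ ≤ _ := norm_sub_le _ _
    _ ≤ _ := by linarith

theorem abs_infDist_sub_le (hβ : IsPisotUnit β) (hK : PhiBound β A K ρ) {P' : ℝ → Set ℝ}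
    (hS : IsBranchSystem β A P) (hS' : IsBranchSystem β A P') {n : ℕ} {t t' : ℝ}
    (ht : t ∈ domain A P) (ht' : t' ∈ domain A P')
    (h : preSet β A P n t = preSet β A P' n t') (g : hyperplane β) :
    |infDist g (fiber β A P t) - infDist g (fiber β A P' t')| ≤ 2 * (K * ρ ^ n) := by
  have h1 := infDist_le_of_preSet_eq hβ hK hS hS' ht h g
  have h2 := infDist_le_of_preSet_eq hβ hK hS' hS ht' h.symm g
  rw [abs_le]
  constructor <;> linarith

/-- If two systems share enough backward orbits of `x`, then their fibers over `x` are nested. -/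
theorem fiber_subset_fiber (hβ : IsPisotUnit β) (hK : PhiBound β A K ρ) {P' : ℝ → Set ℝ}
    (hS : IsBranchSystem β A P) (hS' : IsBranchSystem β A P') {x : ℝ}
    (hfin : (domain A P \ domain A P').Finite) (hx : x ∈ domain A P')
    (hm : ∀ n, ∀ z ∈ domain A P ∩ domain A P', (stepMap β A P)^[n] z = x →
      (stepMap β A P')^[n] z = x) :
    fiber β A P x ⊆ fiber β A P' x := by
  rintro _ ⟨w, ⟨y, hc⟩, rfl⟩
  have hyx : ∀ n, (stepMap β A P)^[n] (y n) = x := fun n => by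
    simpa [hc.1] using hS.iterate_chain hc n 0
  -- Otherwise the orbit eventually stays in a finite set and takes some value infinitely often. If
  -- `y n = y m` with `m > n + N`, applying the map `n` times gives `x = y (m - n)`, which is
  -- outside of `domain A P'`, contrary to `hx`.
  have hfreq : ∀ N, ∃ n ≥ N, y n ∈ domain A P' := by
    by_contra! hcon
    obtain ⟨N, hN⟩ := hcon
    have hQ : ∀ n ≥ N, y n ∈ domain A P \ domain A P' := fun n hn => ⟨hS.chain_mem hc n, hN n hn⟩
    obtain ⟨q, _, hq⟩ : ∃ q ∈ domain A P \ domain A P', {n | N ≤ n ∧ y n = q}.Infinite := by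
      by_contra! hno
      have : (Ici N).Finite := by
        refine (hfin.biUnion fun q hq => hno q hq).subset fun n hn => ?_
        exact mem_biUnion (hQ n hn) ⟨hn, rfl⟩
      exact Set.Ici_infinite N this
    obtain ⟨n, hn, hyn⟩ := hq.nonempty
    obtain ⟨m, ⟨hm1, hym⟩, hm2⟩ := hq.exists_gt (n + N)
    have h1 := hS.iterate_chain hc n (m - n)
    rw [Nat.sub_add_cancel (by omega), hym, ← hyn, hyx] at h1
    exact (hQ (m - n) (by omega)).2 (h1 ▸ hx)
  have hclosed : IsClosed (fiber β A P' x) := (IsBranchSystem.isCompact_fiber hβ.1 hK x).isClosed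
  rw [← hclosed.closure_eq, Metric.mem_closure_iff]
  intro ε hε
  obtain ⟨N, hN⟩ := ((hK.tendsto.const_mul 2).eventually_lt_const
    (by simpa using hε)).exists_forall_of_atTop
  obtain ⟨n, hn, hyn⟩ := hfreq N
  obtain ⟨g, hg, h2⟩ := hS'.exists_fiber_near hβ hK hyn
    (hm n (y n) ⟨hS.chain_mem hc n, hyn⟩ (hyx n))
  refine ⟨g, hg, lt_of_le_of_lt ?_ (hN n hn)⟩
  have h1 := hS.norm_sub_phi_le hβ hK hc n
  rw [dist_eq_norm]
  calc ‖phi β w - g‖ = ‖(Phi β (β ^ n * y n - x) - g) -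
      (Phi β (β ^ n * y n - x) - phi β w)‖ := by congr 1; abel
    _ ≤ _ := norm_sub_le _ _
    _ ≤ _ := by linarith

end Systems

/-! ### One-sided limits of piecewise affine maps -/

/-- Along the filters `l z`, membership in the pieces `P a` converges to membership in `P' a`. -/
structure IsLimitSystem (l : ℝ → Filter ℝ) (P P' : ℝ → Set ℝ) : Prop where
  neBot : ∀ z, (l z).NeBot
  tendsto : ∀ c > 0, ∀ e z : ℝ, Filter.Tendsto (fun t => c * t + e) (l z) (l (c * z + e))
  eventually : ∀ a z, ∀ᶠ t in l z, (t ∈ P a ↔ z ∈ P' a)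

namespace IsLimitSystem

variable {β : ℝ} {A : Finset ℝ} {l : ℝ → Filter ℝ} {P P' : ℝ → Set ℝ}

theorem eventually_domain (hL : IsLimitSystem l P P') (z : ℝ) :
    ∀ᶠ t in l z, (t ∈ domain A P ↔ z ∈ domain A P') := by
  have := (Filter.eventually_all_finset A).2 fun a _ => hL.eventually a z
  filter_upwards [this] with t ht
  rw [mem_domain, mem_domain]
  exact exists_congr fun a => and_congr_right fun ha => ht a ha

/-- Each axiom at a point is read off at a nearby `t` where all the memberships involved have
reached their limits; the digit of a preimage of `t` also serves for the limit point. -/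
theorem isBranchSystem (hβ : 1 < β) (hL : IsLimitSystem l P P') (hS : IsBranchSystem β A P) :
    IsBranchSystem β A P' := by
  have hb : 0 < β := by linarith
  refine ⟨hS.mem_adjoin, ?_, ?_, ?_⟩
  · intro a ha a' ha' x hx hx'
    have := hL.neBot x
    obtain ⟨t, h1, h2⟩ := ((hL.eventually a x).and (hL.eventually a' x)).exists
    exact hS.eq_of_mem a ha a' ha' t (h1.2 hx) (h2.2 hx')
  · intro a ha x hx
    have := hL.neBot x
    have ht := (hL.tendsto β hb (-a) x).eventually (hL.eventually_domain (A := A) (β * x + -a))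
    obtain ⟨t, h1, h2⟩ := (ht.and (hL.eventually a x)).exists
    rw [sub_eq_add_neg, ← h1, ← sub_eq_add_neg]
    exact hS.maps a ha t (h2.2 hx)
  · intro y hy
    have := hL.neBot y
    have ht := (Filter.eventually_all_finset A).2 fun a _ =>
      (hL.tendsto β⁻¹ (inv_pos.2 hb) (β⁻¹ * a) y).eventually
        (hL.eventually a (β⁻¹ * y + β⁻¹ * a))
    obtain ⟨t, h1, h2⟩ := (ht.and (hL.eventually_domain (A := A) y)).exists
    obtain ⟨a, ha, x, hx, hxt⟩ := hS.surj t (h2.2 hy)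
    refine ⟨a, ha, β⁻¹ * y + β⁻¹ * a, (h1 a ha).1 ?_, ?_⟩
    · rw [← hxt]
      convert hx using 1
      field_simp
      ring
    · field_simp
      ring

/-- The quantity `β^n t - T^n t` depends only on the first `n` digits of `t`, and these stabilise
along the filter. -/
theorem eventually_iterate (hβ : 1 < β) (hL : IsLimitSystem l P P') (hS : IsBranchSystem β A P)
    {z : ℝ} (hz : z ∈ domain A P') (n : ℕ) :
    ∀ᶠ t in l z, t ∈ domain A P ∧
      β ^ n * t - (stepMap β A P)^[n] t = β ^ n * z - (stepMap β A P')^[n] z := by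
  have hS' := hL.isBranchSystem hβ hS
  induction n with
  | zero =>
    filter_upwards [hL.eventually_domain (A := A) z] with t ht
    exact ⟨ht.2 hz, by simp⟩
  | succ n ih =>
    set z' := (stepMap β A P')^[n] z with hz'
    have hd := hS'.digitOf_mem (hS'.iterate_mem hz n)
    rw [← hz'] at hd
    have ht := (hL.tendsto (β ^ n) (pow_pos (by linarith) n) (-(β ^ n * z - z')) z).eventually
      (hL.eventually (digitOf A P' z') _)
    filter_upwards [ih, ht] with t h1 h2
    refine ⟨h1.1, ?_⟩
    have e1 : β ^ n * t + -(β ^ n * z - z') = (stepMap β A P)^[n] t := by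
      rw [← h1.2]; ring
    have e2 : β ^ n * z + -(β ^ n * z - z') = z' := by ring
    rw [e1, e2] at h2
    rw [Function.iterate_succ_apply', Function.iterate_succ_apply', ← hz',
      hS.stepMap_eq hd.1 (h2.2 hd.2), hS'.stepMap_eq hd.1 hd.2]
    linear_combination β * h1.2

/-- A number `s` belongs to the set at `t` iff `(t + s) / β^n` is a preimage of order `n` of `t`,
which is eventually decided for each `s`. Only finitely many `s` can ever occur. -/
theorem eventually_preSet (hβ : 1 < β) (hL : IsLimitSystem l P P') (hS : IsBranchSystem β A P)
    (n : ℕ) (x : ℝ) : ∀ᶠ t in l x, preSet β A P n t = preSet β A P' n x := by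
  have hS' := hL.isBranchSystem hβ hS
  have hb : 0 < β ^ n := pow_pos (by linarith) n
  obtain ⟨F, hF, hFs⟩ := exists_finite_preSet_subset hS n
  obtain ⟨F', hF', hFs'⟩ := exists_finite_preSet_subset hS' n
  have hmem : ∀ (P : ℝ → Set ℝ) (t s : ℝ), s ∈ preSet β A P n t ↔
      (β ^ n)⁻¹ * t + (β ^ n)⁻¹ * s ∈ domain A P ∧
      (stepMap β A P)^[n] ((β ^ n)⁻¹ * t + (β ^ n)⁻¹ * s) = t := by
    intro P t s
    constructor
    · rintro ⟨z, hz, hzt, rfl⟩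
      have : (β ^ n)⁻¹ * t + (β ^ n)⁻¹ * (β ^ n * z - t) = z := by field_simp; ring
      rw [this]
      exact ⟨hz, hzt⟩
    · rintro ⟨hz, hzt⟩
      refine ⟨_, hz, hzt, ?_⟩
      field_simp
      ring
  have key : ∀ s : ℝ, ∀ᶠ t in l x, (s ∈ preSet β A P n t ↔ s ∈ preSet β A P' n x) := by
    intro s
    set z₀ := (β ^ n)⁻¹ * x + (β ^ n)⁻¹ * s with hz₀
    have htend := hL.tendsto (β ^ n)⁻¹ (inv_pos.2 hb) ((β ^ n)⁻¹ * s) x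
    rw [← hz₀] at htend
    by_cases hz : z₀ ∈ domain A P'
    · filter_upwards [htend.eventually (hL.eventually_iterate hβ hS hz n)] with t ht
      rw [hmem, hmem, ← hz₀]
      refine and_congr ⟨fun _ => hz, fun _ => ht.1⟩ ?_
      have h2 := ht.2
      have e1 : β ^ n * ((β ^ n)⁻¹ * t + (β ^ n)⁻¹ * s) = t + s := by field_simp
      have e2 : β ^ n * z₀ = x + s := by rw [hz₀]; field_simp
      rw [e1, e2] at h2
      constructor <;> intro h <;> linarith
    · filter_upwards [htend.eventually (hL.eventually_domain (A := A) z₀)] with t ht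
      rw [hmem, hmem, ← hz₀]
      exact iff_of_false (fun h => hz (ht.1 h.1)) (fun h => hz h.1)
  filter_upwards [(Filter.eventually_all_finite (hF.union hF')).2 fun s _ => key s] with t ht
  ext s
  constructor
  · exact fun h => (ht s (Or.inl (hFs _ h))).1 h
  · exact fun h => (ht s (Or.inr (hFs' _ h))).2 h

end IsLimitSystem

/-- A function on `[x, t]` that is right-continuous for the discrete topology, and left-continuous
outside of a finite set `F`, takes at `t` the value at a point of `F`, if `x ∈ F`. -/
theorem exists_mem_eq_of_eventually_eq {α : Type*} {f : ℝ → α} {F : Finset ℝ} {x t : ℝ}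
    (hxt : x ≤ t) (hx : x ∈ F) (hr : ∀ u ∈ Icc x t, ∀ᶠ v in 𝓝[≥] u, f v = f u)
    (hl : ∀ u ∈ Ioc x t, u ∉ F → ∀ᶠ v in 𝓝[<] u, f v = f u) :
    ∃ p ∈ F, p ∈ Icc x t ∧ f p = f t := by
  classical
  let G := F.filter fun p => p ∈ Icc x t
  have hG : G.Nonempty := ⟨x, Finset.mem_filter.2 ⟨hx, left_mem_Icc.2 hxt⟩⟩
  obtain ⟨hp1, hp2⟩ := Finset.mem_filter.1 (G.max'_mem hG)
  refine ⟨G.max' hG, hp1, hp2, ?_⟩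
  -- With `p` the last point of `F` up to `t`, the function is locally constant on both sides
  -- throughout `(p, t]` and to the right at `p`; connectedness of `[p, t]` does the rest.
  set p := G.max' hG
  have hmax : ∀ u ∈ Ioc p t, u ∉ F := fun u hu huF =>
    absurd (G.le_max' u (Finset.mem_filter.2 ⟨huF, hp2.1.trans hu.1.le, hu.2⟩)) (not_le.2 hu.1)
  refine isPreconnected_Icc.induction₂ (fun u v => f u = f v) ?_ (fun _ _ _ _ _ _ => Eq.trans)
    (fun _ _ _ _ => Eq.symm) (left_mem_Icc.2 hp2.2) (right_mem_Icc.2 hp2.2)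
  intro u hu
  have hru := hr u ⟨hp2.1.trans hu.1, hu.2⟩
  rcases hu.1.eq_or_lt with rfl | hpu
  · filter_upwards [(nhdsWithin_mono p Icc_subset_Ici_self) hru] with v hv using hv.symm
  · have hlu := hl u ⟨hp2.1.trans_lt hpu, hu.2⟩ (hmax u ⟨hpu, hu.2⟩)
    have : ∀ᶠ v in 𝓝 u, f v = f u := by
      rw [← nhdsLT_sup_nhdsGE]
      exact Filter.eventually_sup.2 ⟨hlu, hru⟩
    filter_upwards [nhdsWithin_le_nhds this] with v hv using hv.symm

/-! ### The two systems of a right-continuous transformation -/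

namespace BetaTransformation

variable {β : ℝ} (T : BetaTransformation β)

theorem tendsto_affine_nhdsGE {c : ℝ} (hc : 0 < c) (e z : ℝ) :
    Filter.Tendsto (fun t : ℝ => c * t + e) (𝓝[≥] z) (𝓝[≥] (c * z + e)) := by
  refine tendsto_nhdsWithin_iff.2 ⟨tendsto_nhdsWithin_of_tendsto_nhds
    ((by fun_prop : Continuous fun t : ℝ => c * t + e).tendsto z), ?_⟩
  filter_upwards [self_mem_nhdsWithin] with t (ht : z ≤ t)
  change c * z + e ≤ c * t + e
  gcongr

theorem tendsto_affine_nhdsLT {c : ℝ} (hc : 0 < c) (e z : ℝ) :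
    Filter.Tendsto (fun t : ℝ => c * t + e) (𝓝[<] z) (𝓝[<] (c * z + e)) := by
  refine tendsto_nhdsWithin_iff.2 ⟨tendsto_nhdsWithin_of_tendsto_nhds
    ((by fun_prop : Continuous fun t : ℝ => c * t + e).tendsto z), ?_⟩
  filter_upwards [self_mem_nhdsWithin] with t (ht : t < z)
  change c * t + e < c * z + e
  gcongr

theorem isLimitSystem_right : IsLimitSystem (fun z => 𝓝[≥] z) T.piece T.piece := by
  refine ⟨fun z => inferInstance, fun c hc e z => tendsto_affine_nhdsGE hc e z, fun a z => ?_⟩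
  have h : ∀ p ∈ T.I a, ∀ᶠ t in 𝓝[≥] z, (t ∈ Ico p.1 p.2 ↔ z ∈ Ico p.1 p.2) := by
    intro p _
    rcases lt_or_ge z p.1 with h1 | h1
    · filter_upwards [nhdsWithin_le_nhds (Iio_mem_nhds h1)] with t ht
      exact iff_of_false (fun h => absurd h.1 (not_le.2 ht)) (fun h => absurd h.1 (not_le.2 h1))
    · rcases lt_or_ge z p.2 with h2 | h2
      · filter_upwards [nhdsWithin_le_nhds (Iio_mem_nhds h2), self_mem_nhdsWithin] with t ht ht'
        exact iff_of_true ⟨h1.trans ht', ht⟩ ⟨h1, h2⟩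
      · filter_upwards [self_mem_nhdsWithin] with t ht'
        exact iff_of_false (fun h => absurd h.2 (not_lt.2 (h2.trans ht')))
          (fun h => absurd h.2 (not_lt.2 h2))
  filter_upwards [(Filter.eventually_all_finset _).2 h] with t ht
  simp only [piece, mem_iUnion]
  exact exists_congr fun p => exists_congr fun hp => ht p hp

theorem isLimitSystem_left : IsLimitSystem (fun z => 𝓝[<] z) T.piece T.pieceL := by
  refine ⟨fun z => inferInstance, fun c hc e z => tendsto_affine_nhdsLT hc e z, fun a z => ?_⟩
  have h : ∀ p ∈ T.I a, ∀ᶠ t in 𝓝[<] z, (t ∈ Ico p.1 p.2 ↔ z ∈ Ioc p.1 p.2) := by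
    intro p _
    rcases le_or_gt z p.1 with h1 | h1
    · filter_upwards [self_mem_nhdsWithin] with t ht
      exact iff_of_false (fun h => absurd h.1 (not_le.2 (ht.trans_le h1)))
        (fun h => absurd h.1 (not_lt.2 h1))
    · rcases le_or_gt z p.2 with h2 | h2
      · filter_upwards [nhdsWithin_le_nhds (Ioi_mem_nhds h1), self_mem_nhdsWithin] with t ht ht'
        exact iff_of_true ⟨le_of_lt ht, ht'.trans_le h2⟩ ⟨h1, h2⟩
      · filter_upwards [nhdsWithin_le_nhds (Ioi_mem_nhds h2)] with t ht'
        exact iff_of_false (fun h => absurd h.2 (not_lt.2 (le_of_lt ht')))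
          (fun h => absurd h.2 (not_le.2 h2))
  filter_upwards [(Filter.eventually_all_finset _).2 h] with t ht
  simp only [piece, pieceL, mem_iUnion]
  exact exists_congr fun p => exists_congr fun hp => ht p hp

theorem isBranchSystem (hA : ∀ a ∈ T.A, a ∈ Algebra.adjoin ℤ {β}) :
    IsBranchSystem β T.A T.piece := by
  have hs : (⋃ a ∈ T.A, (fun x : ℝ => β * x - a) '' T.piece a) = domain T.A T.piece := T.surj
  refine ⟨hA, ?_, ?_, ?_⟩
  · intro a ha a' ha' x hx hx'
    by_contra hne
    exact Set.disjoint_left.1 (T.disjoint a ha a' ha' hne) hx hx'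
  · intro a ha x hx
    rw [← hs]
    exact mem_biUnion ha ⟨x, hx, rfl⟩
  · intro y hy
    rw [← hs] at hy
    simpa using hy

theorem isBranchSystemL (hβ : 1 < β) (hA : ∀ a ∈ T.A, a ∈ Algebra.adjoin ℤ {β}) :
    IsBranchSystem β T.A T.pieceL :=
  T.isLimitSystem_left.isBranchSystem hβ (T.isBranchSystem hA)

theorem finite_X_diff_XL : (T.X \ T.XL).Finite := by
  refine (T.A.finite_toSet.biUnion fun a _ =>
    ((T.I a).finite_toSet.image Prod.fst)).subset ?_
  rintro x ⟨hx, hx'⟩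
  simp only [X, XL, piece, pieceL, mem_iUnion, not_exists] at hx hx'
  obtain ⟨a, ha, p, hp, hxp⟩ := hx
  refine mem_biUnion ha ⟨p, hp, ?_⟩
  by_contra hne
  exact hx' a ha p hp ⟨lt_of_le_of_ne hxp.1 hne, hxp.2.le⟩

theorem finite_XL_diff_X : (T.XL \ T.X).Finite := by
  refine (T.A.finite_toSet.biUnion fun a _ =>
    ((T.I a).finite_toSet.image Prod.snd)).subset ?_
  rintro x ⟨hx, hx'⟩
  simp only [X, XL, piece, pieceL, mem_iUnion, not_exists] at hx hx'
  obtain ⟨a, ha, p, hp, hxp⟩ := hx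
  refine mem_biUnion ha ⟨p, hp, ?_⟩
  by_contra hne
  exact hx' a ha p hp ⟨hxp.1.le, lt_of_le_of_ne hxp.2 (Ne.symm hne)⟩

theorem exists_abs_le : ∃ R, 0 < R ∧ ∀ x ∈ T.X, |x| ≤ R := by
  have hb : Bornology.IsBounded T.X := by
    rw [X, Bornology.isBounded_biUnion_finset]
    intro a _
    rw [piece, Bornology.isBounded_biUnion_finset]
    exact fun p _ => isBounded_Ico _ _
  obtain ⟨R, hR, h⟩ := hb.exists_pos_norm_le
  exact ⟨R, hR, h⟩

/-! ### Preimages under `T` and `T̃` of points outside of `𝒱` -/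

section Matching

variable {T} (hβ : 1 < β) (hA : ∀ a ∈ T.A, a ∈ Algebra.adjoin ℤ {β})
include hβ hA

/-- If the two orbits of `z` did not meet at some time `1 ≤ m ≤ n`, then `x` would be in `𝒱`. The
meeting point lies in both domains again, so the argument restarts there with `n - m` steps left. -/
theorem iterate_eq_and_of_or {x : ℝ} (hx : x ∈ T.X) (hxV : x ∉ T.V) (n : ℕ) :
    ∀ z ∈ T.X ∩ T.XL, (T.map^[n] z = x ∨ T.mapL^[n] z = x) →
      T.map^[n] z = x ∧ T.mapL^[n] z = x := by
  induction n using Nat.strong_induction_on with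
  | _ n ih =>
    intro z hz h
    rcases Nat.eq_zero_or_pos n with rfl | hn
    · simpa using h
    have hex : ∃ m, 1 ≤ m ∧ m ≤ n ∧ T.mapL^[m] z = T.map^[m] z := by
      by_contra! hno
      exact hxV (Or.inr ⟨hx, z, hz, n, hn, hno, h.imp Eq.symm Eq.symm⟩)
    obtain ⟨m, hm1, hmn, hm⟩ := hex
    have hz' : T.map^[m] z ∈ T.X ∩ T.XL :=
      ⟨(T.isBranchSystem hA).iterate_mem hz.1 m,
        hm ▸ (T.isBranchSystemL hβ hA).iterate_mem hz.2 m⟩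
    have := ih (n - m) (by omega) _ hz'
    have e : ∀ f : ℝ → ℝ, f^[n] z = f^[n - m] (f^[m] z) := fun f => by
      rw [← Function.iterate_add_apply, Nat.sub_add_cancel hmn]
    rw [e, e, hm] at h ⊢
    exact this h

/-- Only preimages in exactly one of the two domains could make a difference. The sets excluded by
`h1` and `h2` have cardinalities bounded independently of `n`. -/
theorem preSet_eq_preSetL {x : ℝ} (hx : x ∈ T.X) (hxV : x ∉ T.V) (n : ℕ)
    (h1 : x ∉ T.map^[n] '' (T.X \ T.XL)) (h2 : x ∉ T.mapL^[n] '' (T.XL \ T.X)) :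
    preSet β T.A T.pieceL n x = preSet β T.A T.piece n x := by
  ext s
  constructor
  · rintro ⟨z, hz, hzx, rfl⟩
    have hz' : z ∈ T.X := by
      by_contra hno
      exact h2 ⟨z, ⟨hz, hno⟩, hzx⟩
    exact ⟨z, hz', (iterate_eq_and_of_or hβ hA hx hxV n z ⟨hz', hz⟩ (Or.inr hzx)).1, rfl⟩
  · rintro ⟨z, hz, hzx, rfl⟩
    have hz' : z ∈ T.XL := by
      by_contra hno
      exact h1 ⟨z, ⟨hz, hno⟩, hzx⟩
    exact ⟨z, hz', (iterate_eq_and_of_or hβ hA hx hxV n z ⟨hz, hz'⟩ (Or.inl hzx)).2, rfl⟩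

end Matching

theorem mem_XL_of_notMem_V {x : ℝ} (hx : x ∈ T.X) (hxV : x ∉ T.V) : x ∈ T.XL := by
  by_contra h
  exact hxV (Or.inl ⟨hx, h⟩)

/-! ### Constancy of the fibers between points of `𝒱` -/

section Constancy

variable {T} {K ρ : ℝ} (hβ : IsPisotUnit β) (hA : ∀ a ∈ T.A, a ∈ Algebra.adjoin ℤ {β})
include hβ hA

theorem fiberL_eq_fiber {x : ℝ} (hx : x ∈ T.X) (hxV : x ∉ T.V) :
    fiber β T.A T.pieceL x = fiber β T.A T.piece x := by
  obtain ⟨K, ρ, hK⟩ := exists_phiBound hβ hA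
  have hS := T.isBranchSystem hA
  have hS' := T.isBranchSystemL hβ.1 hA
  refine Subset.antisymm ?_ ?_
  · exact fiber_subset_fiber hβ hK hS' hS T.finite_XL_diff_X hx fun n z hz h =>
      (iterate_eq_and_of_or hβ.1 hA hx hxV n z hz.symm (Or.inr h)).1
  · exact fiber_subset_fiber hβ hK hS hS' T.finite_X_diff_XL (T.mem_XL_of_notMem_V hx hxV)
      fun n z hz h => (iterate_eq_and_of_or hβ.1 hA hx hxV n z hz (Or.inl h)).2

/-- From the left, the fibers approach the fiber of the left-continuous system, which is the same
set at points outside of `𝒱`. -/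
theorem continuousOn_infDist_fiber {x y : ℝ} (hX : Icc x y ⊆ T.X) (hV : ∀ t ∈ Ioc x y, t ∉ T.V)
    (g : hyperplane β) :
    ContinuousOn (fun t => infDist g (fiber β T.A T.piece t)) (Icc x y) := by
  obtain ⟨K, ρ, hK⟩ := exists_phiBound hβ hA
  have hS := T.isBranchSystem hA
  have hS' := T.isBranchSystemL hβ.1 hA
  intro u hu
  have hright : ContinuousWithinAt (fun t => infDist g (fiber β T.A T.piece t)) (Ici u) u := by
    rw [Metric.continuousWithinAt_iff']
    intro ε hε
    obtain ⟨n, hn⟩ := ((hK.tendsto.const_mul 2).eventually_lt_const (by simpa using hε)).exists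
    filter_upwards [T.isLimitSystem_right.eventually_preSet hβ.1 hS n u,
      T.isLimitSystem_right.eventually_domain (A := T.A) u] with t h1 h2
    exact (abs_infDist_sub_le hβ hK hS hS (h2.2 (hX hu)) (hX hu) h1 g).trans_lt hn
  rcases hu.1.eq_or_lt with rfl | hxu
  · exact hright.mono Icc_subset_Ici_self
  have huV := hV u ⟨hxu, hu.2⟩
  have huL := T.mem_XL_of_notMem_V (hX hu) huV
  have hleft : ContinuousWithinAt (fun t => infDist g (fiber β T.A T.piece t)) (Iio u) u := by
    rw [Metric.continuousWithinAt_iff']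
    intro ε hε
    obtain ⟨n, hn⟩ := ((hK.tendsto.const_mul 2).eventually_lt_const (by simpa using hε)).exists
    filter_upwards [T.isLimitSystem_left.eventually_preSet hβ.1 hS n u,
      T.isLimitSystem_left.eventually_domain (A := T.A) u] with t h1 h2
    rw [Real.dist_eq, ← fiberL_eq_fiber hβ hA (hX hu) huV]
    exact (abs_infDist_sub_le hβ hK hS hS' (h2.2 huL) huL h1 g).trans_lt hn
  have := hleft.union hright
  rw [Iio_union_Ici] at this
  exact this.mono (subset_univ _)

/-- The image of `[x, y]` contains the interval between the two end values, yet is covered by at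
most `N` balls of radius `2 K ρ^n`, with `N` independent of `n`; so this interval has length `0`. -/
theorem infDist_fiber_eq {x y : ℝ} (hxy : x ≤ y) (hX : Icc x y ⊆ T.X)
    (hV : ∀ t ∈ Ioc x y, t ∉ T.V) (g : hyperplane β) :
    infDist g (fiber β T.A T.piece x) = infDist g (fiber β T.A T.piece y) := by
  classical
  obtain ⟨K, ρ, hK⟩ := exists_phiBound hβ hA
  have hS := T.isBranchSystem hA
  set f : ℝ → ℝ := fun t => infDist g (fiber β T.A T.piece t) with hf
  let N := T.finite_X_diff_XL.toFinset.card + T.finite_XL_diff_X.toFinset.card + 1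
  have hbound : ∀ n, |f y - f x| ≤ N * (2 * (2 * (K * ρ ^ n))) := by
    intro n
    have hpos : 0 ≤ 2 * (K * ρ ^ n) :=
      mul_nonneg zero_le_two (mul_nonneg hK.pos.le (pow_nonneg hK.rate_pos.le _))
    -- Besides the left end `x`, these are the only points at which the set of order `n` can jump
    -- from the left.
    let F : Finset ℝ := insert x (T.finite_X_diff_XL.toFinset.image T.map^[n] ∪
      T.finite_XL_diff_X.toFinset.image T.mapL^[n])
    have hcard : F.card ≤ N := by
      refine (Finset.card_insert_le _ _).trans (Nat.succ_le_succ ?_)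
      exact (Finset.card_union_le _ _).trans
        (add_le_add Finset.card_image_le Finset.card_image_le)
    have hsub : uIcc (f x) (f y) ⊆ ⋃ p ∈ F, closedBall (f p) (2 * (K * ρ ^ n)) := by
      have hc : ContinuousOn f (uIcc x y) := by
        rw [uIcc_of_le hxy]; exact continuousOn_infDist_fiber hβ hA hX hV g
      refine (intermediate_value_uIcc hc).trans ?_
      rintro _ ⟨t, ht, rfl⟩
      rw [uIcc_of_le hxy] at ht
      obtain ⟨p, hpF, hp, hpt⟩ := exists_mem_eq_of_eventually_eq
        (f := fun t => preSet β T.A T.piece n t) (F := F) ht.1 (Finset.mem_insert_self _ _)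
        (fun u _ => T.isLimitSystem_right.eventually_preSet hβ.1 hS n u) (fun u hu huF => by
          rw [Finset.mem_insert, Finset.mem_union, not_or, not_or] at huF
          have hu' : u ∈ Ioc x y := ⟨hu.1, hu.2.trans ht.2⟩
          rw [← preSet_eq_preSetL hβ.1 hA (hX (Ioc_subset_Icc_self hu')) (hV u hu') n
            (by simpa using huF.2.1) (by simpa using huF.2.2)]
          exact T.isLimitSystem_left.eventually_preSet hβ.1 hS n u)
      refine mem_biUnion (show p ∈ (F : Set ℝ) from hpF) ?_
      rw [mem_closedBall, Real.dist_eq]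
      exact abs_infDist_sub_le hβ hK hS hS (hX ht) (hX ⟨hp.1, hp.2.trans ht.2⟩) hpt.symm g
    have h1 := measure_mono (μ := volume) hsub
    rw [Real.volume_interval] at h1
    have h2 := h1.trans (measure_biUnion_finset_le F _)
    simp only [Real.volume_closedBall] at h2
    rw [Finset.sum_const, nsmul_eq_mul, ← ENNReal.ofReal_natCast,
      ← ENNReal.ofReal_mul (Nat.cast_nonneg _), ENNReal.ofReal_le_ofReal_iff (by positivity)] at h2
    refine h2.trans ?_
    gcongr
  have hlim : Filter.Tendsto (fun n : ℕ => N * (2 * (2 * (K * ρ ^ n)))) Filter.atTop (𝓝 0) := by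
    simpa using ((hK.tendsto.const_mul 2).const_mul 2).const_mul (N : ℝ)
  have := ge_of_tendsto' hlim hbound
  exact (sub_eq_zero.1 (abs_eq_zero.1 (le_antisymm this (abs_nonneg _)))).symm

/-- The fibers over `[x, y] ⊂ X` agree if `(x, y]` does not meet `𝒱`. -/
theorem fiber_eq_of_Icc {x y : ℝ} (hxy : x ≤ y) (hX : Icc x y ⊆ T.X)
    (hV : ∀ t ∈ Ioc x y, t ∉ T.V) : fiber β T.A T.piece x = fiber β T.A T.piece y := by
  obtain ⟨K, ρ, hK⟩ := exists_phiBound hβ hA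
  have hS := T.isBranchSystem hA
  have hmem : ∀ t ∈ T.X, ∀ g, g ∈ fiber β T.A T.piece t ↔
      infDist g (fiber β T.A T.piece t) = 0 := fun t ht g =>
    (IsBranchSystem.isCompact_fiber hβ.1 hK t).isClosed.mem_iff_infDist_zero (hS.fiber_nonempty ht)
  ext g
  rw [hmem x (hX (left_mem_Icc.2 hxy)), hmem y (hX (right_mem_Icc.2 hxy)),
    infDist_fiber_eq hβ hA hxy hX hV]

end Constancy

end BetaTransformation

namespace BetaTransformation

variable {β : ℝ} (T : BetaTransformation β)

/-! ### The natural extension domain as a union of fibers -/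

section Expansions

variable {T} (hβ : 1 < β) (hA : ∀ a ∈ T.A, a ∈ Algebra.adjoin ℤ {β})

theorem digit_geometric_bound (hβ : 1 < β) : ∃ u : ℕ → ℝ, Summable u ∧
    ∀ n : ℕ, ∀ a ∈ T.A, ‖a * (β ^ (n + 1))⁻¹‖ ≤ u n := by
  obtain ⟨M, hM⟩ := (T.A.finite_toSet.image norm).bddAbove
  refine ⟨fun n => M * β⁻¹ * β⁻¹ ^ n, (summable_geometric_of_lt_one
    (inv_nonneg.2 (by linarith)) (inv_lt_one_of_one_lt₀ hβ)).mul_left _, fun n a ha => ?_⟩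
  have hb : 0 < β := by linarith
  rw [norm_mul, norm_inv, norm_pow, Real.norm_of_nonneg hb.le, pow_succ', mul_inv, ← mul_assoc,
    ← inv_pow]
  dsimp only
  gcongr
  exact hM ⟨a, ha, rfl⟩

theorem expansion_iterate (x : ℝ) (m n : ℕ) :
    T.expansion (T.map^[m] x) n = T.expansion x (n + m) := by
  rw [expansion, expansion, Function.iterate_add_apply]

include hA in
theorem expansion_mem {x : ℝ} (hx : x ∈ T.X) (n : ℕ) : T.expansion x n ∈ T.A :=
  ((T.isBranchSystem hA).digitOf_mem ((T.isBranchSystem hA).iterate_mem hx n)).1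

include hβ hA in
theorem hasSum_expansion {x : ℝ} (hx : x ∈ T.X) :
    HasSum (fun n : ℕ => T.expansion x n * (β ^ (n + 1))⁻¹) x := by
  have hb : 0 < β := by linarith
  obtain ⟨u, hu, hle⟩ := digit_geometric_bound (T := T) hβ
  obtain ⟨R, hR, hX⟩ := T.exists_abs_le
  have hsum : Summable fun n : ℕ => ‖T.expansion x n * (β ^ (n + 1))⁻¹‖ :=
    Summable.of_nonneg_of_le (fun _ => norm_nonneg _)
      (fun n => hle n _ (expansion_mem hA hx n)) hu
  rw [hasSum_iff_tendsto_nat_of_summable_norm hsum]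
  have hpart : ∀ n, ∑ k ∈ Finset.range n, T.expansion x k * (β ^ (k + 1))⁻¹ =
      x - T.map^[n] x * β⁻¹ ^ n := by
    intro n
    induction n with
    | zero => simp
    | succ n ih =>
      rw [Finset.sum_range_succ, ih, Function.iterate_succ_apply', map, expansion, inv_pow, inv_pow]
      field_simp
      ring
  simp only [hpart]
  have h0 : Filter.Tendsto (fun n : ℕ => T.map^[n] x * β⁻¹ ^ n) Filter.atTop (𝓝 0) := by
    refine squeeze_zero_norm (a := fun n => R * β⁻¹ ^ n) (fun n => ?_) ?_
    · rw [norm_mul, norm_pow, Real.norm_of_nonneg (inv_nonneg.2 hb.le)]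
      gcongr
      exact hX _ ((T.isBranchSystem hA).iterate_mem hx n)
    · simpa using (tendsto_pow_atTop_nhds_zero_of_lt_one (inv_nonneg.2 hb.le)
        (inv_lt_one_of_one_lt₀ hβ)).const_mul R
  simpa using h0.const_sub x

include hβ hA in
theorem expansion_injOn : InjOn T.expansion T.X := fun x hx y hy h =>
  (hasSum_expansion hβ hA hx).unique (by rw [h]; exact hasSum_expansion hβ hA hy)

theorem concat_neg (w b : ℕ → ℝ) (m : ℕ) : concat w b (-(m : ℤ)) = w m := by
  simp [concat]

theorem concat_pos (w b : ℕ → ℝ) (m : ℕ) : concat w b ((m : ℤ) + 1) = b m := by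
  rw [concat, if_neg (by omega), add_sub_cancel_right, Int.toNat_natCast]

include hβ hA in
-- Expansions determine their points, so the points `z m` whose expansions start at index `-m`
-- satisfy `T (z (m + 1)) = z m` and `T (z 0) = x`: they form a backward orbit.
theorem concat_expansion_mem_iff {x : ℝ} (hx : x ∈ T.X) (w : ℕ → ℝ) :
    concat w (T.expansion x) ∈ T.seqSpace ↔ ∃ y, IsChain β T.A T.piece x w y := by
  have hS := T.isBranchSystem hA
  constructor
  · rintro ⟨-, hu⟩
    have hu' := fun m : ℕ => hu (-(m : ℤ))
    choose z hz he using hu'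
    have he' : ∀ m n : ℕ, concat w (T.expansion x) (-(m : ℤ) + n) = T.expansion (z m) n :=
      fun m n => congrFun (he m) n
    have hdig : ∀ m, w m = digitOf T.A T.piece (z m) := fun m => by
      have := he' m 0
      rwa [Nat.cast_zero, add_zero, concat_neg] at this
    have hstep : ∀ m, T.map (z m) = Nat.casesOn m x z := by
      intro m
      cases m with
      | zero =>
        refine expansion_injOn hβ hA (hS.stepMap_mem (hz 0)) hx (funext fun n => ?_)
        change T.expansion (z 0) (n + 1) = T.expansion x n
        rw [← he' 0 (n + 1), ← concat_pos w (T.expansion x) n]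
        congr 1
        push_cast
        ring
      | succ m =>
        refine expansion_injOn hβ hA (hS.stepMap_mem (hz _)) (hz m) (funext fun n => ?_)
        change T.expansion (z (m + 1)) (n + 1) = T.expansion (z m) n
        rw [← he' (m + 1) (n + 1), ← he' m n]
        congr 1
        push_cast
        ring
    -- The index shifts by one: `y 0 = x` and `y (m + 1) = z m`.
    refine ⟨fun m => Nat.casesOn m x z, rfl, fun m => ?_⟩
    have hd := hS.digitOf_mem (hz m)
    refine ⟨hdig m ▸ hd.1, ?_, ?_⟩
    · rw [hdig m]; exact hd.2
    · rw [hdig m]; exact hstep m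
  · rintro ⟨y, hy⟩
    refine ⟨fun k => ?_, fun k => ?_⟩
    · rw [concat]
      split_ifs
      · exact (hy.2 _).1
      · exact expansion_mem hA hx _
    · rcases le_or_gt k 0 with hk | hk
      · obtain ⟨m, rfl⟩ : ∃ m : ℕ, k = -(m : ℤ) := ⟨(-k).toNat, by omega⟩
        refine ⟨y (m + 1), hS.chain_mem hy _, funext fun n => ?_⟩
        rcases le_or_gt n m with hn | hn
        · have h1 : -(m : ℤ) + n = -((m - n : ℕ) : ℤ) := by omega
          have h2 := hS.iterate_chain hy n (m - n + 1)
          rw [show m - n + 1 + n = m + 1 by omega] at h2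
          have h3 : T.map^[n] (y (m + 1)) = y (m - n + 1) := h2
          rw [h1, concat_neg, expansion, h3, hS.digitOf_eq (hy.2 _).1 (hy.2 _).2.1]
        · have h1 : -(m : ℤ) + n = ((n - (m + 1) : ℕ) : ℤ) + 1 := by omega
          have h2 : T.map^[m + 1] (y (m + 1)) = x := by
            have := hS.iterate_chain hy (m + 1) 0
            rwa [zero_add, hy.1] at this
          rw [h1, concat_pos]
          nth_rewrite 1 [← h2]
          rw [expansion_iterate, Nat.sub_add_cancel hn]
      · obtain ⟨m, rfl⟩ : ∃ m : ℕ, k = (m : ℤ) + 1 := ⟨(k - 1).toNat, by omega⟩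
        refine ⟨T.map^[m] x, hS.iterate_mem hx m, funext fun n => ?_⟩
        rw [expansion_iterate, ← concat_pos w (T.expansion x) (n + m)]
        congr 1
        push_cast
        ring

include hβ hA in
theorem tileD_eq_fiber {x : ℝ} (hx : x ∈ T.X) : T.tileD x = fiber β T.A T.piece x := by
  simp only [tileD, fiber, concat_expansion_mem_iff hβ hA hx]

include hβ hA in
theorem mem_natExt {y : Space β} : y ∈ T.natExt ↔
    ∃ x ∈ T.X, ∃ g ∈ T.tileD x, y = x • v1 β - g := by
  constructor
  · rintro ⟨u, hu, rfl⟩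
    obtain ⟨x, hx, he⟩ := hu.2 1
    have he' : ∀ n : ℕ, u (n + 1) = T.expansion x n := fun n => by
      rw [← congrFun he n, add_comm]
    refine ⟨x, hx, phi β fun n : ℕ => u (-(n : ℤ)), ⟨_, ?_, rfl⟩, ?_⟩
    · have : concat (fun n : ℕ => u (-(n : ℤ))) (T.expansion x) = u := by
        funext k
        rcases le_or_gt k 0 with hk | hk
        · obtain ⟨m, rfl⟩ : ∃ m : ℕ, k = -(m : ℤ) := ⟨(-k).toNat, by omega⟩
          rw [concat_neg]
        · obtain ⟨m, rfl⟩ : ∃ m : ℕ, k = (m : ℤ) + 1 := ⟨(k - 1).toNat, by omega⟩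
          rw [concat_pos, he']
      change concat _ _ ∈ T.seqSpace
      rwa [this]
    · simp only [psi, he', (hasSum_expansion hβ hA hx).tsum_eq]
  · rintro ⟨x, hx, _, ⟨w, hw, rfl⟩, rfl⟩
    refine ⟨concat w (T.expansion x), hw, ?_⟩
    simp only [psi, concat_neg, concat_pos, (hasSum_expansion hβ hA hx).tsum_eq]

end Expansions

/-! ### Compactness of `Ŷ` -/

section Closure

variable {T} (hβ : IsPisotUnit β) (hA : ∀ a ∈ T.A, a ∈ Algebra.adjoin ℤ {β})
include hβ hA

theorem continuousOn_psi : ContinuousOn (psi β) (univ.pi fun _ => (T.A : Set ℝ)) := by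
  obtain ⟨K, ρ, hK⟩ := exists_phiBound hβ hA
  obtain ⟨u, hu, hle⟩ := digit_geometric_bound (T := T) hβ.1
  refine ContinuousOn.sub (ContinuousOn.smul (f := fun w : ℤ → ℝ => ∑' n : ℕ,
    w (n + 1) * (β ^ (n + 1))⁻¹) (g := fun _ => v1 β) ?_ continuousOn_const) ?_
  · refine continuousOn_tsum (u := u) (fun n => ?_) hu fun n w hw => hle n _ (hw _ (mem_univ _))
    exact ((continuous_apply _).mul continuous_const).continuousOn
  · refine continuous_subtype_val.comp_continuousOn (hK.continuousOn_phi.comp ?_ ?_)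
    · exact (continuous_pi fun n => continuous_apply _).continuousOn
    · exact fun w hw n _ => hw _ (mem_univ _)

omit hβ hA in
theorem closure_seqSpace_subset : closure T.seqSpace ⊆ univ.pi fun _ => (T.A : Set ℝ) :=
  closure_minimal (fun _ hu k _ => hu.1 k)
    (isClosed_set_pi fun _ _ => T.A.finite_toSet.isClosed)

theorem isCompact_natExtClosure : IsCompact T.natExtClosure :=
  ((isCompact_univ_pi fun _ => T.A.finite_toSet.isCompact).of_isClosed_subset isClosed_closure
    closure_seqSpace_subset).image_of_continuousOn
    ((continuousOn_psi hβ hA).mono closure_seqSpace_subset)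

theorem natExtClosure_eq : T.natExtClosure = closure T.natExt := by
  refine Subset.antisymm ?_ ?_
  · exact ((continuousOn_psi hβ hA).mono closure_seqSpace_subset).image_closure
  · exact closure_minimal (image_mono subset_closure) (isCompact_natExtClosure hβ hA).isClosed

end Closure

/-! ### The fibers are piecewise constant -/

section Piecewise

variable {T} (hβ : IsPisotUnit β) (hA : ∀ a ∈ T.A, a ∈ Algebra.adjoin ℤ {β})

theorem eventually_X_nhdsGE (x : ℝ) : ∀ᶠ t in 𝓝[≥] x, (t ∈ T.X ↔ x ∈ T.X) :=
  T.isLimitSystem_right.eventually_domain (A := T.A) x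

theorem eventually_X_nhdsLT (x : ℝ) : ∀ᶠ t in 𝓝[<] x, (t ∈ T.X ↔ x ∈ T.XL) :=
  T.isLimitSystem_left.eventually_domain (A := T.A) x

include hβ hA

theorem tileD_eq_of_Icc {x y : ℝ} (hxy : x ≤ y) (hX : Icc x y ⊆ T.X)
    (hV : ∀ t ∈ Ioc x y, t ∉ T.V) : T.tileD x = T.tileD y := by
  rw [tileD_eq_fiber hβ.1 hA (hX (left_mem_Icc.2 hxy)),
    tileD_eq_fiber hβ.1 hA (hX (right_mem_Icc.2 hxy)), fiber_eq_of_Icc hβ hA hxy hX hV]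

theorem eventually_tileD_nhdsGE (hV : T.V.Finite) {x : ℝ} (hx : x ∈ T.X) :
    ∀ᶠ t in 𝓝[≥] x, t ∈ T.X ∧ T.tileD t = T.tileD x := by
  have h1 : ∀ᶠ t in 𝓝[≥] x, t ∈ T.X := (eventually_X_nhdsGE x).mono fun t ht => ht.2 hx
  have h2 : ∀ᶠ t in 𝓝[≥] x, t ∉ T.V \ {x} :=
    nhdsWithin_le_nhds ((hV.subset sdiff_subset).isClosed.isOpen_compl.mem_nhds (by simp))
  obtain ⟨b, hb, h⟩ := mem_nhdsGE_iff_exists_Ico_subset.1 (h1.and h2)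
  filter_upwards [Ico_mem_nhdsGE hb] with t ht
  refine ⟨(h ht).1, (tileD_eq_of_Icc hβ hA ht.1 (fun u hu => (h ⟨hu.1, hu.2.trans_lt ht.2⟩).1)
    fun u hu huV => ?_).symm⟩
  exact (h ⟨hu.1.le, hu.2.trans_lt ht.2⟩).2 ⟨huV, hu.1.ne'⟩

theorem eventually_tileD_nhds (hV : T.V.Finite) {x : ℝ} (hx : x ∈ T.X) (hxV : x ∉ T.V) :
    ∀ᶠ t in 𝓝 x, t ∈ T.X ∧ T.tileD t = T.tileD x := by
  rw [← nhdsLT_sup_nhdsGE, Filter.eventually_sup]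
  refine ⟨?_, eventually_tileD_nhdsGE hβ hA hV hx⟩
  have h1 : ∀ᶠ t in 𝓝[<] x, t ∈ T.X :=
    (eventually_X_nhdsLT x).mono fun t ht => ht.2 (T.mem_XL_of_notMem_V hx hxV)
  have h2 : ∀ᶠ t in 𝓝[<] x, t ∉ T.V :=
    nhdsWithin_le_nhds (hV.isClosed.isOpen_compl.mem_nhds hxV)
  obtain ⟨b, hb, h⟩ := mem_nhdsLT_iff_exists_Ioo_subset.1 (h1.and h2)
  filter_upwards [Ioo_mem_nhdsLT hb] with t ht
  refine ⟨(h ht).1, tileD_eq_of_Icc hβ hA ht.2.le (fun u hu => ?_) fun u hu huV => ?_⟩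
  · rcases hu.2.eq_or_lt with rfl | hlt
    · exact hx
    · exact (h ⟨ht.1.trans_le hu.1, hlt⟩).1
  · rcases hu.2.eq_or_lt with rfl | hlt
    · exact hxV huV
    · exact (h ⟨ht.1.trans hu.1, hlt⟩).2 huV

omit hβ hA in
theorem eventually_notMem_X {x : ℝ} (hx : x ∉ T.X) (hx' : x ∉ T.XL) : ∀ᶠ t in 𝓝 x, t ∉ T.X := by
  rw [← nhdsLT_sup_nhdsGE, Filter.eventually_sup]
  exact ⟨(eventually_X_nhdsLT x).mono fun t ht h => hx' (ht.1 h),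
    (eventually_X_nhdsGE x).mono fun t ht h => hx (ht.1 h)⟩

omit hβ hA in
/-- Every point of `X` is joined to a point of `𝒱` on its left by an interval inside of `X`. -/
theorem exists_V_Icc_subset {y : ℝ} (hy : y ∈ T.X) : ∃ v ∈ T.V, v ≤ y ∧ Icc v y ⊆ T.X := by
  obtain ⟨R, hR, hX⟩ := T.exists_abs_le
  let S : Set ℝ := {t | t ≤ y ∧ Icc t y ⊆ T.X}
  have hyS : y ∈ S := ⟨le_rfl, by rw [Icc_self]; exact singleton_subset_iff.2 hy⟩
  have hbdd : BddBelow S := ⟨-R, fun t ht => (abs_le.1 (hX t (ht.2 (left_mem_Icc.2 ht.1)))).1⟩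
  -- Right-continuity puts the infimum in `X`. If it were in `X̃` too, the interval could be
  -- extended to the left; hence it lies in `X ∖ X̃ ⊂ 𝒱`.
  set v := sInf S with hv
  have hvy : v ≤ y := csInf_le hbdd hyS
  have hIoc : Ioc v y ⊆ T.X := fun u hu => by
    obtain ⟨t, ht, htu⟩ := exists_lt_of_csInf_lt ⟨y, hyS⟩ hu.1
    exact ht.2 ⟨htu.le, hu.2⟩
  have hvX : v ∈ T.X := by
    rcases hvy.eq_or_lt with h | h
    · rwa [h]
    · obtain ⟨t, h1, h2⟩ := ((eventually_X_nhdsGE (T := T) v).filter_mono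
        (nhdsWithin_mono v Ioi_subset_Ici_self)).and (Ioc_mem_nhdsGT h) |>.exists
      exact h1.1 (hIoc h2)
  have hIcc : Icc v y ⊆ T.X := fun u hu => by
    rcases hu.1.eq_or_lt with rfl | h
    · exact hvX
    · exact hIoc ⟨h, hu.2⟩
  refine ⟨v, Or.inl ⟨hvX, fun hvL => ?_⟩, hvy, hIcc⟩
  obtain ⟨b, hb, h⟩ := mem_nhdsLT_iff_exists_Ioo_subset.1
    ((eventually_X_nhdsLT (T := T) v).mono fun t ht => ht.2 hvL)
  obtain ⟨c, hc⟩ := exists_between (show b < v from hb)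
  have : c ∈ S := ⟨hc.2.le.trans hvy, fun u hu => by
    rcases lt_or_ge u v with h' | h'
    · exact h ⟨hc.1.trans_le hu.1, h'⟩
    · exact hIcc ⟨h', hu.2⟩⟩
  exact absurd (csInf_le hbdd this) (not_le.2 hc.2)

/-- The fiber over a point of `X` is the fiber over the largest point of `𝒱` on its left. -/
theorem tileD_eq_of_isGreatest {y v : ℝ} (hy : y ∈ T.X) (hv : IsGreatest {v ∈ T.V | v ≤ y} v) :
    T.tileD v = T.tileD y := by
  obtain ⟨v', hv', hvy', hI⟩ := exists_V_Icc_subset hy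
  refine tileD_eq_of_Icc hβ hA hv.1.2 (fun u hu => hI ⟨(hv.2 ⟨hv', hvy'⟩).trans hu.1, hu.2⟩)
    fun u hu huV => ?_
  exact absurd (hv.2 ⟨huV, hu.2⟩) (not_le.2 hu.1)

omit hβ hA in
theorem exists_isGreatest_V (hV : T.V.Finite) {y : ℝ} (hy : y ∈ T.X) :
    ∃ v, IsGreatest {v ∈ T.V | v ≤ y} v := by
  obtain ⟨v', hv', hvy', -⟩ := exists_V_Icc_subset hy
  have hfin : {v ∈ T.V | v ≤ y}.Finite := hV.subset fun v hv => hv.1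
  obtain ⟨v, hv, hm⟩ := exists_max_image _ id hfin ⟨v', hv', hvy'⟩
  exact ⟨v, hv, fun u hu => hm u hu⟩

theorem finite_tileD (hV : T.V.Finite) : (T.tileD '' T.X).Finite := by
  refine (hV.image T.tileD).subset ?_
  rintro _ ⟨y, hy, rfl⟩
  obtain ⟨v, hv⟩ := exists_isGreatest_V hV hy
  exact ⟨v, hv.1.1, tileD_eq_of_isGreatest hβ hA hy hv⟩

theorem isCompact_tileD {x : ℝ} (hx : x ∈ T.X) : IsCompact (T.tileD x) := by
  obtain ⟨K, ρ, hK⟩ := exists_phiBound hβ hA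
  rw [tileD_eq_fiber hβ.1 hA hx]
  exact IsBranchSystem.isCompact_fiber hβ.1 hK x

theorem exists_norm_tileD_le : ∃ K, 0 < K ∧ ∀ x ∈ T.X, ∀ g ∈ T.tileD x, ‖g‖ ≤ K := by
  obtain ⟨K, ρ, hK⟩ := exists_phiBound hβ hA
  refine ⟨K, hK.pos, fun x hx g hg => ?_⟩
  rw [tileD_eq_fiber hβ.1 hA hx] at hg
  exact (T.isBranchSystem hA).norm_le_of_mem_fiber hβ hK hg

/-- The set of the pairs `(x, g)` with `x ∈ X` and `g ∈ 𝒟_x` is measurable. -/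
theorem measurableSet_graph (hV : T.V.Finite) :
    MeasurableSet {p : ℝ × hyperplane β | p.1 ∈ T.X ∧ p.2 ∈ T.tileD p.1} := by
  have hXm : MeasurableSet T.X := by
    refine T.A.measurableSet_biUnion fun a _ => (T.I a).measurableSet_biUnion fun p _ => ?_
    exact measurableSet_Ico
  have hfin : {v ∈ T.V | v ∈ T.X}.Finite := hV.subset fun v hv => hv.1
  have heq : {p : ℝ × hyperplane β | p.1 ∈ T.X ∧ p.2 ∈ T.tileD p.1} =
      ⋃ v ∈ {v ∈ T.V | v ∈ T.X},
        (T.X ∩ (Ici v \ ⋃ u ∈ {u ∈ T.V | v < u}, Ici u)) ×ˢ T.tileD v := by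
    ext ⟨x, g⟩
    simp only [mem_iUnion, mem_prod, exists_prop]
    constructor
    · rintro ⟨hx, hg⟩
      obtain ⟨v, hv⟩ := exists_isGreatest_V hV hx
      obtain ⟨v', hv', hvy', hI⟩ := exists_V_Icc_subset hx
      refine ⟨v, ⟨hv.1.1, hI ⟨hv.2 ⟨hv', hvy'⟩, hv.1.2⟩⟩, ⟨hx, hv.1.2, ?_⟩, ?_⟩
      · simp only [mem_iUnion, not_exists]
        exact fun u hu hux => absurd (hv.2 ⟨hu.1, hux⟩) (not_le.2 hu.2)
      · rwa [tileD_eq_of_isGreatest hβ hA hx hv]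
    · rintro ⟨v, hv, ⟨hx, hvx, hno⟩, hg⟩
      refine ⟨hx, ?_⟩
      have : IsGreatest {v ∈ T.V | v ≤ x} v := ⟨⟨hv.1, hvx⟩, fun u hu => by
        by_contra hlt
        exact hno (mem_biUnion (⟨hu.1, not_le.1 hlt⟩ : u ∈ {u ∈ T.V | v < u}) hu.2)⟩
      change g ∈ T.tileD x
      rwa [← tileD_eq_of_isGreatest hβ hA hx this]
  rw [heq]
  refine hfin.measurableSet_biUnion fun v hv => MeasurableSet.prod (hXm.inter
    (measurableSet_Ici.diff ((hV.subset fun u hu => hu.1).measurableSet_biUnion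
      fun u _ => measurableSet_Ici))) (isCompact_tileD hβ hA hv.2).measurableSet

end Piecewise

end BetaTransformation

/-! ### Null sets in the coordinates `(x, h) ↦ x v_1 + h` and on the torus -/

instance isAddHaarMeasure_hyperplaneMeasure (β : ℝ) : (hyperplaneMeasure β).IsAddHaarMeasure := by
  unfold hyperplaneMeasure; infer_instance

/-- Both are Haar measures on `ℝ^d` and so have the same null sets; no Jacobian is needed. -/
theorem ae_coordEquiv_iff {β : ℝ} (hβ : IsPisotUnit β) {p : Space β → Prop} :
    (∀ᵐ y, p y) ↔ ∀ᵐ q ∂(volume : Measure ℝ).prod (hyperplaneMeasure β), p (coordEquiv hβ q) := by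
  set ν := (volume : Measure ℝ).prod (hyperplaneMeasure β)
  have : (ν.map (coordEquiv hβ)).IsAddHaarMeasure := (coordEquiv hβ).isAddHaarMeasure_map ν
  have h1 : ν.map (coordEquiv hβ) ≪ volume := Measure.absolutelyContinuous_isAddHaarMeasure _ _
  have h2 : (volume : Measure (Space β)) ≪ ν.map (coordEquiv hβ) :=
    Measure.absolutelyContinuous_isAddHaarMeasure _ _
  have h3 : MeasurableEmbedding (coordEquiv hβ) :=
    (coordEquiv hβ).toHomeomorph.measurableEmbedding
  exact ⟨fun h => h3.ae_map_iff.1 (h1.ae_le h), fun h => h2.ae_le (h3.ae_map_iff.2 h)⟩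

theorem ae_torus_iff_restrict {d : ℕ} (a : Fin d → ℝ) {p : UnitAddTorus (Fin d) → Prop} :
    (∀ᵐ q, p q) ↔ ∀ᵐ y ∂(volume : Measure (Fin d → ℝ)).restrict {y | ∀ i, y i ∈ Ioc (a i) (a i + 1)},
      p fun i => (y i : UnitAddCircle) := by
  have hm : MeasurableSet {y : Fin d → ℝ | ∀ i, y i ∈ Ioc (a i) (a i + 1)} :=
    MeasurableSet.univ_pi' fun i => measurableSet_Ioc
  have hvol : (Measure.pi fun _ : Fin d => (AddCircle.haarAddCircle : Measure UnitAddCircle)) =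
      (volume : Measure (UnitAddTorus (Fin d))) := by
    rw [volume_pi]
    congr 1
    funext i
    rw [AddCircle.volume_eq_smul_haarAddCircle, ENNReal.ofReal_one, one_smul]
  have hp := (UnitAddTorus.measurePreserving_equivPiIoc a).symm.map_eq.trans hvol
  rw [ae_restrict_iff_subtype hm, ← hp,
    (UnitAddTorus.measurableEquivPiIoc a).symm.measurableEmbedding.ae_map_iff]
  rfl

theorem ae_torus_iff {d : ℕ} {p : UnitAddTorus (Fin d) → Prop} :
    (∀ᵐ q, p q) ↔ ∀ᵐ y : Fin d → ℝ, p fun i => (y i : UnitAddCircle) := by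
  constructor
  · intro h
    have h1 : ∀ n : Fin d → ℤ, ∀ᵐ y ∂(volume : Measure (Fin d → ℝ)).restrict
        {y | ∀ i, y i ∈ Ioc (n i : ℝ) (n i + 1)}, p fun i => (y i : UnitAddCircle) :=
      fun n => (ae_torus_iff_restrict _).1 h
    have h2 := ae_restrict_iUnion_iff _ _ |>.2 h1
    have h3 : (⋃ n : Fin d → ℤ, {y : Fin d → ℝ | ∀ i, y i ∈ Ioc (n i : ℝ) (n i + 1)}) = univ := by
      refine eq_univ_of_forall fun y => mem_iUnion.2 ⟨fun i => ⌈y i⌉ - 1, fun i => ?_⟩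
      have := Int.ceil_lt_add_one (y i)
      have := Int.le_ceil (y i)
      push_cast
      constructor <;> linarith
    rwa [h3, Measure.restrict_univ] at h2
  · exact fun h => (ae_torus_iff_restrict 0).2 (ae_restrict_of_ae h)

theorem toTorus_eq_iff {β : ℝ} (y z : Space β) :
    (fun i => ((y i : ℝ) : UnitAddCircle)) = (fun i => ((z i : ℝ) : UnitAddCircle)) ↔
      ∃ n, z - intVec β n = y := by
  have h1 : ∀ a b : ℝ, (a : UnitAddCircle) = (b : UnitAddCircle) ↔ ∃ n : ℤ, b - n = a := by
    intro a b
    rw [eq_comm, ← sub_eq_zero, ← AddCircle.coe_sub, AddCircle.coe_eq_zero_iff]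
    refine exists_congr fun n => ?_
    rw [zsmul_eq_mul, mul_one]
    constructor <;> intro h <;> linarith
  rw [funext_iff]
  simp only [h1]
  constructor
  · intro h
    choose n hn using h
    exact ⟨n, by ext i; exact hn i⟩
  · rintro ⟨n, rfl⟩ i
    exact ⟨n i, rfl⟩

instance countable_adjoin (β : ℝ) : Countable (Algebra.adjoin ℤ {β}) := by
  have hc : Countable ℤ[X] := by
    rw [← Cardinal.mk_le_aleph0_iff]
    exact Polynomial.cardinalMk_le_max.trans (by simp)
  have h : Countable (aeval (R := ℤ) β).range :=
    (countable_range (aeval (R := ℤ) β)).to_subtype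
  rwa [← Algebra.adjoin_singleton_eq_range_aeval] at h

/-! ### Coverings of `ℝ^d` and of its slices parallel to `H` -/

namespace BetaTransformation

variable {β : ℝ} (T : BetaTransformation β)

/-- The point `x v_1 + h` belongs to exactly one of the sets `embed ξ + X̂`, `ξ ∈ ℤ[β]`. -/
def CoveredOnce (x : ℝ) (h : hyperplane β) : Prop :=
  ∃! ξ : Algebra.adjoin ℤ {β}, x - ξ ∈ T.X ∧ Phi β ξ - h ∈ T.tileD (x - ξ)

section Covering

variable {T} (hβ : IsPisotUnit β) (hA : ∀ a ∈ T.A, a ∈ Algebra.adjoin ℤ {β})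
include hβ hA

theorem coordEquiv_mem_natExt {x : ℝ} {h : hyperplane β} :
    coordEquiv hβ (x, h) ∈ T.natExt ↔ x ∈ T.X ∧ -h ∈ T.tileD x := by
  rw [mem_natExt hβ.1 hA]
  constructor
  · rintro ⟨x', hx', g, hg, he⟩
    have h1 : x' • v1 β - (g : Space β) = coordEquiv hβ (x', -g) := by
      rw [coordEquiv_apply, Submodule.coe_neg, sub_eq_add_neg]
    rw [h1] at he
    obtain ⟨h2, h3⟩ := Prod.ext_iff.1 ((coordEquiv hβ).injective he)
    dsimp only at h2 h3
    rw [h2, h3, neg_neg]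
    exact ⟨hx', hg⟩
  · rintro ⟨hx, hg⟩
    exact ⟨x, hx, -h, hg, by rw [coordEquiv_apply, Submodule.coe_neg, sub_neg_eq_add]⟩

theorem coordEquiv_sub_embed_mem_natExt {x ξ : ℝ} {h : hyperplane β} :
    coordEquiv hβ (x, h) - embed β ξ ∈ T.natExt ↔
      x - ξ ∈ T.X ∧ Phi β ξ - h ∈ T.tileD (x - ξ) := by
  rw [← coordEquiv_Phi hβ, ← map_sub, Prod.mk_sub_mk, coordEquiv_mem_natExt hβ hA, neg_sub]

theorem existsUnique_intVec_iff {x : ℝ} {h : hyperplane β} :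
    (∃! n, coordEquiv hβ (x, h) - intVec β n ∈ T.natExt) ↔ T.CoveredOnce x h := by
  constructor
  · rintro ⟨n, hn, hu⟩
    obtain ⟨ξ, hξ, he⟩ := exists_embed_eq_intVec hβ.2.1 n
    refine ⟨⟨ξ, hξ⟩, (coordEquiv_sub_embed_mem_natExt hβ hA).1 (he ▸ hn), fun ξ' hξ' => ?_⟩
    obtain ⟨n', hn'⟩ := exists_intVec_eq_embed hβ.2.1 ξ'.2
    have := hu n' (by
      dsimp only
      rw [← hn']
      exact (coordEquiv_sub_embed_mem_natExt hβ hA).2 hξ')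
    subst this
    exact Subtype.ext (embed_injective hβ (hn'.trans he.symm))
  · rintro ⟨ξ, hξ, hu⟩
    obtain ⟨n, hn⟩ := exists_intVec_eq_embed hβ.2.1 ξ.2
    refine ⟨n, ?_, fun n' hn' => ?_⟩
    · dsimp only
      rw [← hn]
      exact (coordEquiv_sub_embed_mem_natExt hβ hA).2 hξ
    obtain ⟨ξ', hξ', he⟩ := exists_embed_eq_intVec hβ.2.1 n'
    have := hu ⟨ξ', hξ'⟩ ((coordEquiv_sub_embed_mem_natExt hβ hA).1 (he ▸ hn'))
    refine intVec_injective (β := β) ?_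
    rw [← he, ← hn, ← this]

omit hβ hA in
theorem tilesTorus_iff :
    T.TilesTorus ↔ ∀ᵐ y : Space β, ∃! n, y - intVec β n ∈ T.natExt := by
  have hu : ∀ y : Space β, (∃! z : Space β, z ∈ T.natExt ∧
      (fun i => ((z i : ℝ) : UnitAddCircle)) = fun i => ((y i : ℝ) : UnitAddCircle)) ↔
      ∃! n, y - intVec β n ∈ T.natExt := by
    intro y
    simp only [toTorus_eq_iff]
    constructor
    · rintro ⟨_, ⟨hz, n, rfl⟩, hu⟩
      refine ⟨n, hz, fun n' hn' => ?_⟩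
      have := hu _ ⟨hn', n', rfl⟩
      exact intVec_injective (β := β) (sub_right_injective this)
    · rintro ⟨n, hn, hu⟩
      refine ⟨_, ⟨hn, n, rfl⟩, ?_⟩
      rintro _ ⟨hz, n', rfl⟩
      rw [hu n' hz]
  rw [TilesTorus, ae_torus_iff]
  have hme : MeasurableEmbedding (WithLp.toLp 2 : (Fin (deg β) → ℝ) → Space β) :=
    (MeasurableEquiv.toLp 2 (Fin (deg β) → ℝ)).measurableEmbedding
  have hp := PiLp.volume_preserving_toLp (Fin (deg β))
  rw [← hp.map_eq, hme.ae_map_iff]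
  simp only [← hu]

omit hA in
-- Invariance under the lattice, by the reindexing `ξ ↦ ξ + x₀`; it moves slice `x` to slice `x +
-- x₀`.
theorem coveredOnce_add_iff {x : ℝ} {h : hyperplane β} (x₀ : Algebra.adjoin ℤ {β}) :
    T.CoveredOnce (x + x₀) (h + Phi β x₀) ↔ T.CoveredOnce x h := by
  rw [CoveredOnce, CoveredOnce]
  refine ((Equiv.addRight x₀).existsUnique_congr fun {ξ} => ?_).symm
  have h1 : x + x₀ - ((Equiv.addRight x₀ ξ : Algebra.adjoin ℤ {β}) : ℝ) = x - ξ := by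
    simp
  have h2 : Phi β ((Equiv.addRight x₀ ξ : Algebra.adjoin ℤ {β}) : ℝ) - (h + Phi β x₀) =
      Phi β ξ - h := by
    have : ((Equiv.addRight x₀ ξ : Algebra.adjoin ℤ {β}) : ℝ) = ξ + x₀ := rfl
    rw [this, Phi_add hβ.2.1 ξ.2 x₀.2]
    abel
  rw [h1, h2]

/-- In a bounded part of `H`, the covering is locally constant to the right. -/
theorem eventually_coveredOnce_iff (hV : T.V.Finite) (x₀ R : ℝ) :
    ∀ᶠ x in 𝓝[≥] x₀, ∀ h : hyperplane β, ‖h‖ ≤ R → (T.CoveredOnce x h ↔ T.CoveredOnce x₀ h) := by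
  obtain ⟨K, hK, hKD⟩ := exists_norm_tileD_le hβ hA
  obtain ⟨M, hM, hMX⟩ := T.exists_abs_le
  -- Only these finitely many `ξ` can cover a point with `‖h‖ ≤ R` and `|x| ≤ |x₀| + 1`, so one
  -- neighbourhood of `x₀` serves for all of them.
  have hfin := finite_adjoin_bounded hβ (|x₀| + 1 + M) (K + R)
  have hloc : ∀ ξ : ℝ, ∀ᶠ x in 𝓝[≥] x₀, (x - ξ ∈ T.X ↔ x₀ - ξ ∈ T.X) ∧
      (x₀ - ξ ∈ T.X → T.tileD (x - ξ) = T.tileD (x₀ - ξ)) := by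
    intro ξ
    have ht : Filter.Tendsto (fun x => x - ξ) (𝓝[≥] x₀) (𝓝[≥] (x₀ - ξ)) := by
      have := tendsto_affine_nhdsGE one_pos (-ξ) x₀
      simpa [← sub_eq_add_neg] using this
    by_cases hx : x₀ - ξ ∈ T.X
    · filter_upwards [ht.eventually (eventually_tileD_nhdsGE hβ hA hV hx)] with x hx'
      exact ⟨iff_of_true hx'.1 hx, fun _ => hx'.2⟩
    · filter_upwards [ht.eventually (eventually_X_nhdsGE (T := T) (x₀ - ξ))] with x hx'
      exact ⟨hx', fun h => absurd h hx⟩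
  filter_upwards [(Filter.eventually_all_finite hfin).2 fun ξ _ => hloc ξ,
    Icc_mem_nhdsGE (show x₀ < x₀ + 1 by linarith)] with x hx hx1 h hh
  have hxabs : |x| ≤ |x₀| + 1 := by
    have : |x - x₀| ≤ 1 := abs_le.2 ⟨by linarith [hx1.1], by linarith [hx1.2]⟩
    calc |x| = |x₀ + (x - x₀)| := by ring_nf
      _ ≤ |x₀| + |x - x₀| := abs_add_le _ _
      _ ≤ _ := by linarith
  have hb : ∀ x' : ℝ, |x'| ≤ |x₀| + 1 → ∀ ξ : Algebra.adjoin ℤ {β},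
      x' - ξ ∈ T.X → Phi β ξ - h ∈ T.tileD (x' - ξ) →
      (ξ : ℝ) ∈ {x | x ∈ Algebra.adjoin ℤ {β} ∧ |x| ≤ |x₀| + 1 + M ∧ ‖Phi β x‖ ≤ K + R} := by
    intro x' hx' ξ h1 h2
    refine ⟨ξ.2, ?_, ?_⟩
    · have h3 := hMX _ h1
      calc |(ξ : ℝ)| = |x' - (x' - ξ)| := by ring_nf
        _ ≤ |x'| + |x' - ξ| := abs_sub _ _
        _ ≤ _ := by linarith
    · have h3 := hKD _ h1 _ h2
      calc ‖Phi β ξ‖ = ‖(Phi β ξ - h) + h‖ := by rw [sub_add_cancel]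
        _ ≤ _ := (norm_add_le _ _).trans (add_le_add h3 hh)
  refine existsUnique_congr fun ξ => ⟨fun ⟨h1, h2⟩ => ?_, fun ⟨h1, h2⟩ => ?_⟩
  · have := hx ξ (hb x hxabs ξ h1 h2)
    exact ⟨this.1.1 h1, this.2 (this.1.1 h1) ▸ h2⟩
  · have := hx ξ (hb x₀ (by linarith) ξ h1 h2)
    exact ⟨this.1.2 h1, (this.2 h1).symm ▸ h2⟩

/-- The good slice near `x₀` is chosen depending on the radius `R`; countably many balls exhaust
`H`. -/
theorem ae_coveredOnce_of_frequently (hV : T.V.Finite) {x₀ : ℝ}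
    (h : ∃ᶠ x in 𝓝[≥] x₀, ∀ᵐ g ∂hyperplaneMeasure β, T.CoveredOnce x g) :
    ∀ᵐ g ∂hyperplaneMeasure β, T.CoveredOnce x₀ g := by
  have hR : ∀ R : ℕ, ∀ᵐ g ∂hyperplaneMeasure β, ‖g‖ ≤ R → T.CoveredOnce x₀ g := by
    intro R
    obtain ⟨x, hx, hx'⟩ := (h.and_eventually (eventually_coveredOnce_iff hβ hA hV x₀ R)).exists
    filter_upwards [hx] with g hg hgR
    exact (hx' g hgR).1 hg
  filter_upwards [ae_all_iff.2 hR] with g hg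
  obtain ⟨R, hR⟩ := exists_nat_ge ‖g‖
  exact hg R hR

theorem measurableSet_coveredOnce (hV : T.V.Finite) :
    MeasurableSet {p : ℝ × hyperplane β | T.CoveredOnce p.1 p.2} := by
  have hE : ∀ ξ : Algebra.adjoin ℤ {β}, MeasurableSet {p : ℝ × hyperplane β |
      p.1 - ξ ∈ T.X ∧ Phi β ξ - p.2 ∈ T.tileD (p.1 - ξ)} := by
    intro ξ
    have hm : Measurable fun p : ℝ × hyperplane β => (p.1 - (ξ : ℝ), Phi β ξ - p.2) := by
      have : Continuous fun p : ℝ × hyperplane β => (p.1 - (ξ : ℝ), Phi β ξ - p.2) := by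
        fun_prop
      exact this.measurable
    exact hm (measurableSet_graph hβ hA hV)
  have : {p : ℝ × hyperplane β | T.CoveredOnce p.1 p.2} = ⋃ ξ : Algebra.adjoin ℤ {β},
      ({p : ℝ × hyperplane β | p.1 - ξ ∈ T.X ∧ Phi β ξ - p.2 ∈ T.tileD (p.1 - ξ)} \
      ⋃ ξ' : {ξ' : Algebra.adjoin ℤ {β} // ξ' ≠ ξ}, {p : ℝ × hyperplane β |
        p.1 - ξ'.1 ∈ T.X ∧ Phi β ξ'.1 - p.2 ∈ T.tileD (p.1 - ξ'.1)}) := by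
    ext p
    simp only [mem_iUnion, mem_ofPred_eq, mem_sdiff, not_exists]
    constructor
    · rintro ⟨ξ, hξ, hu⟩
      exact ⟨ξ, hξ, fun ξ' h' => ξ'.2 (hu _ h')⟩
    · rintro ⟨ξ, hξ, hu⟩
      refine ⟨ξ, hξ, fun ξ' h' => ?_⟩
      by_contra hne
      exact hu ⟨ξ', hne⟩ h'
  rw [this]
  exact MeasurableSet.iUnion fun ξ => (hE ξ).diff (MeasurableSet.iUnion fun ξ' => hE ξ'.1)

/-- The translates of `X̂` cover almost every point once if and only if they do so on the
hyperplane `H`. -/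
theorem ae_existsUnique_intVec_iff (hV : T.V.Finite) :
    (∀ᵐ y : Space β, ∃! n, y - intVec β n ∈ T.natExt) ↔
      ∀ᵐ g ∂hyperplaneMeasure β, T.CoveredOnce 0 g := by
  rw [ae_coordEquiv_iff hβ]
  have heq : (∀ᵐ q ∂(volume : Measure ℝ).prod (hyperplaneMeasure β),
      ∃! n, coordEquiv hβ q - intVec β n ∈ T.natExt) ↔
      ∀ᵐ q ∂(volume : Measure ℝ).prod (hyperplaneMeasure β), T.CoveredOnce q.1 q.2 :=
    Filter.eventually_congr (Filter.Eventually.of_forall fun q =>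
      existsUnique_intVec_iff hβ hA (x := q.1) (h := q.2))
  rw [heq, Measure.ae_prod_iff_ae_ae (measurableSet_coveredOnce hβ hA hV)]
  constructor
  · intro h
    -- Almost every slice is good, and `[0, b)` has positive length, so it contains a good one.
    refine ae_coveredOnce_of_frequently hβ hA hV ?_
    rw [(nhdsGE_basis (0 : ℝ)).frequently_iff]
    intro b hb
    by_contra hno
    replace hno : ∀ x ∈ Ico 0 b, ¬ ∀ᵐ g ∂hyperplaneMeasure β, T.CoveredOnce x g :=
      fun x hx hx' => hno ⟨x, hx, hx'⟩
    have : volume (Ico (0 : ℝ) b) = 0 :=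
      measure_mono_null (fun x hx => hno x hx) h
    rw [Real.volume_Ico, ENNReal.ofReal_eq_zero] at this
    linarith
  · intro h
    refine Filter.Eventually.of_forall fun x₀ => ae_coveredOnce_of_frequently hβ hA hV ?_
    rw [(nhdsGE_basis x₀).frequently_iff]
    intro b hb
    -- Slice `ξ ∈ ℤ[β]` is slice `0` translated by `Φ(ξ)`, hence good.
    obtain ⟨ξ, hξ, hξ'⟩ := (dense_adjoin hβ).exists_between hb
    refine ⟨ξ, ⟨hξ'.1.le, hξ'.2⟩, ?_⟩
    have hmp := measurePreserving_sub_right (hyperplaneMeasure β) (Phi β ξ)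
    filter_upwards [hmp.quasiMeasurePreserving.ae h] with g hg
    have := (coveredOnce_add_iff hβ (x := 0) (h := g - Phi β ξ) ⟨ξ, hξ⟩).2 hg
    simpa using this

end Covering

end BetaTransformation

/-! ### Self-similarity of the fibers -/

section SelfSimilarity

variable {β : ℝ} {A : Finset ℝ} {P : ℝ → Set ℝ} {K ρ : ℝ}

theorem shiftH_pow_Phi (hβ : IsPisotUnit β) {x : ℝ} (hx : x ∈ Algebra.adjoin ℤ {β}) (n : ℕ) :
    (shiftH hβ ^ n) (Phi β x) = Phi β (x * β ^ n) := by
  induction n with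
  | zero => simp
  | succ n ih =>
    rw [pow_succ', Module.End.mul_apply, ih, shiftH_Phi hβ (mul_mem hx (pow_mem self_mem_adjoin n))]
    congr 1
    ring

theorem isOpenMap_shiftH_pow (hβ : IsPisotUnit β) (n : ℕ) : IsOpenMap (shiftH hβ ^ n) := by
  induction n with
  | zero => exact IsOpenMap.id
  | succ n ih =>
    rw [pow_succ', Module.End.mul_eq_comp, LinearMap.coe_comp]
    exact (isOpenMap_shiftH hβ).comp ih

/-- The fiber over `x` contains contracted copies of the fibers over the preimages of `x`. -/
theorem IsBranchSystem.add_shiftH_pow_mem_fiber (hβ : IsPisotUnit β) (hK : PhiBound β A K ρ)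
    (hS : IsBranchSystem β A P) {x : ℝ} {w y : ℕ → ℝ} (hc : IsChain β A P x w y) (n : ℕ)
    {g : hyperplane β} (hg : g ∈ fiber β A P (y n)) :
    Phi β (β ^ n * y n - x) + (shiftH hβ ^ n) g ∈ fiber β A P x ∧
      ‖Phi β (β ^ n * y n - x) + (shiftH hβ ^ n) g - phi β w‖ ≤ 2 * (K * ρ ^ n) := by
  obtain ⟨w', ⟨y', hc'⟩, rfl⟩ := hg
  obtain ⟨w'', y'', hc'', h1, h2, h3⟩ := chain_append hc n hc'
  have hwA : ∀ k, w' k ∈ A := fun k => (hc'.2 k).1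
  have hw''A : ∀ k, w'' k ∈ A := fun k => (hc''.2 k).1
  have hy'' : y'' n = y n := by
    have := h3 0
    rwa [add_zero, hc'.1] at this
  have heq : Phi β (β ^ n * y n - x) + (shiftH hβ ^ n) (phi β w') = phi β w'' := by
    rw [← hy'', pow_mul_chain_sub hc'',
      Phi_sum hβ.2.1 _ fun k => mul_mem (hS.mem_adjoin _ (hw''A k)) (pow_mem self_mem_adjoin k),
      phi, phi, ← (hK.summable hw''A).sum_add_tsum_nat_add n]
    congr 1
    have := (LinearMap.toContinuousLinearMap (shiftH hβ ^ n)).map_tsum (hK.summable hwA)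
    rw [LinearMap.coe_toContinuousLinearMap'] at this
    rw [this]
    refine tsum_congr fun k => ?_
    rw [shiftH_pow_Phi hβ (mul_mem (hS.mem_adjoin _ (hwA k)) (pow_mem self_mem_adjoin k)),
      mul_assoc, ← pow_add, add_comm k n, h2]
  rw [heq]
  refine ⟨⟨w'', ⟨y'', hc''⟩, rfl⟩, ?_⟩
  have e1 := hS.norm_sub_phi_le hβ hK hc n
  have e2 := hS.norm_sub_phi_le hβ hK hc'' n
  rw [hy''] at e2
  calc ‖phi β w'' - phi β w‖ = ‖(Phi β (β ^ n * y n - x) - phi β w) -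
      (Phi β (β ^ n * y n - x) - phi β w'')‖ := by congr 1; abel
    _ ≤ _ := norm_sub_le _ _
    _ ≤ _ := by linarith

end SelfSimilarity

namespace BetaTransformation

variable {β : ℝ} {T : BetaTransformation β} (hβ : IsPisotUnit β)
  (hA : ∀ a ∈ T.A, a ∈ Algebra.adjoin ℤ {β})
include hβ hA

/-! ### Positivity of the measure of the fibers and nullity of `Ŷ ∖ X̂` -/

omit hA in
theorem proj1_coordEquiv (x : ℝ) (h : hyperplane β) : proj1 β (coordEquiv hβ (x, h)) = x := by
  rw [coordEquiv_apply, proj1_smul_add hβ _ h.2]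

omit hA in
theorem measurable_proj1 : Measurable (proj1 β) := by
  have : proj1 β = fun y => ((coordEquiv hβ).symm y).1 := funext (proj1_eq hβ)
  rw [this]
  exact (continuous_fst.comp (coordEquiv hβ).symm.continuous).measurable

/-- The fibers agree on some `[x, b)`; if they were null, `μ` would vanish on `(x, b)`, which is a
neighbourhood of a point of `X`. -/
theorem measure_tileD_ne_zero (hsupp : T.X ⊆ T.invMeasure.support) (hV : T.V.Finite) {x : ℝ}
    (hx : x ∈ T.X) : hyperplaneMeasure β (T.tileD x) ≠ 0 := by
  intro h0
  obtain ⟨b, hb, h⟩ := mem_nhdsGE_iff_exists_Ico_subset.1 (eventually_tileD_nhdsGE hβ hA hV hx)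
  obtain ⟨m, hm⟩ := exists_between (show x < b from hb)
  have hpos := (Measure.mem_support_iff_forall m).1 (hsupp (h ⟨hm.1.le, hm.2⟩).1) (Ioo x b)
    (Ioo_mem_nhds hm.1 hm.2)
  rw [invMeasure, Measure.map_apply (measurable_proj1 hβ) measurableSet_Ioo,
    Measure.restrict_apply (measurable_proj1 hβ measurableSet_Ioo)] at hpos
  refine hpos.ne' (measure_eq_zero_iff_ae_notMem.2 ((ae_coordEquiv_iff hβ).2 ?_))
  have h1 : ∀ᵐ g ∂hyperplaneMeasure β, -g ∉ T.tileD x :=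
    (Measure.measurePreserving_neg (hyperplaneMeasure β)).quasiMeasurePreserving.ae
      (measure_eq_zero_iff_ae_notMem.1 h0)
  filter_upwards [Measure.quasiMeasurePreserving_snd.ae h1] with ⟨t, g⟩ hg
  rintro ⟨ht, hmem⟩
  rw [mem_preimage, proj1_coordEquiv] at ht
  rw [coordEquiv_mem_natExt hβ hA] at hmem
  rw [(h (Ioo_subset_Ico_self ht)).2] at hmem
  exact hg hmem.2

/-- For `x ∈ X` off `𝒱` the fiber is compact and constant on a two-sided neighbourhood, so limits
stay in `X̂`. For `x` outside of `X` and `X̃`, no points of `X` are near. -/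
theorem mem_natExt_of_mem_natExtClosure (hV : T.V.Finite) {x : ℝ} {g : hyperplane β}
    (hxV : x ∉ T.V) (hx' : x ∉ T.XL \ T.X) (h : coordEquiv hβ (x, g) ∈ T.natExtClosure) :
    coordEquiv hβ (x, g) ∈ T.natExt := by
  rw [natExtClosure_eq hβ hA, mem_closure_iff_frequently] at h
  have hf : ∃ᶠ p in 𝓝 (x, g), coordEquiv hβ p ∈ T.natExt := by
    have h2 := (coordEquiv hβ).toHomeomorph.map_nhds_eq (x, g)
    change ∃ᶠ y in 𝓝 ((coordEquiv hβ).toHomeomorph (x, g)), _ at h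
    rw [← h2] at h
    exact h
  have hfst : Filter.Tendsto Prod.fst (𝓝 (x, g)) (𝓝 x) := continuous_fst.tendsto (x, g)
  by_cases hx : x ∈ T.X
  · rw [coordEquiv_mem_natExt hβ hA]
    refine ⟨hx, ?_⟩
    have hev := hfst.eventually (eventually_tileD_nhds hβ hA hV hx hxV)
    have hcl : IsClosed {p : ℝ × hyperplane β | -p.2 ∈ T.tileD x} :=
      (isCompact_tileD hβ hA hx).isClosed.preimage (by fun_prop)
    have : (x, g) ∈ closure {p : ℝ × hyperplane β | -p.2 ∈ T.tileD x} := by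
      rw [mem_closure_iff_frequently]
      refine (hf.and_eventually hev).mono fun p hp => ?_
      have := ((coordEquiv_mem_natExt hβ hA (x := p.1) (h := p.2)).1 hp.1).2
      rwa [hp.2.2] at this
    rwa [hcl.closure_eq] at this
  · have hev := hfst.eventually (eventually_notMem_X hx fun h => hx' ⟨h, hx⟩)
    obtain ⟨p, hp, hp'⟩ := (hf.and_eventually hev).exists
    exact absurd ((coordEquiv_mem_natExt hβ hA (x := p.1) (h := p.2)).1 hp).1 hp'

theorem ae_natExtClosure (hV : T.V.Finite) :
    ∀ᵐ y : Space β, ∀ n, y - intVec β n ∈ T.natExtClosure ↔ y - intVec β n ∈ T.natExt := by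
  rw [ae_all_iff]
  intro n
  have h : ∀ᵐ y : Space β, y ∈ T.natExtClosure ↔ y ∈ T.natExt := by
    rw [ae_coordEquiv_iff hβ]
    have h1 : ∀ᵐ x : ℝ, x ∉ T.V ∪ (T.XL \ T.X) :=
      measure_eq_zero_iff_ae_notMem.1 ((hV.union T.finite_XL_diff_X).measure_zero _)
    filter_upwards [Measure.quasiMeasurePreserving_fst.ae h1] with ⟨x, g⟩ hx
    refine ⟨mem_natExt_of_mem_natExtClosure hβ hA hV (fun h => hx (Or.inl h))
      (fun h => hx (Or.inr h)), fun h => ?_⟩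
    rw [natExtClosure_eq hβ hA]
    exact subset_closure h
  exact (measurePreserving_sub_right volume (intVec β n)).quasiMeasurePreserving.ae h

/-! ### The tilings and the covering property -/

omit hβ hA in
theorem encard_space_eq_one_iff (y : Space β) (S : Set (Space β)) :
    {n | y ∈ intVec β n +ᵥ S}.encard = 1 ↔ ∃! n, y - intVec β n ∈ S := by
  have : {n | y ∈ intVec β n +ᵥ S} = {n | y - intVec β n ∈ S} := by
    ext n
    simp only [mem_ofPred_eq, mem_vadd_set_iff_neg_vadd_mem, vadd_eq_add]
    rw [neg_add_eq_sub]
  rw [this, encard_eq_one]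
  simp only [eq_singleton_iff_unique_mem]
  rfl

omit hA in
theorem encard_tile_eq_one_iff (y : hyperplane β) :
    {i : T.tileIndex | y ∈ Phi β i +ᵥ T.tileD i}.encard = 1 ↔ T.CoveredOnce 0 (-y) := by
  have hmem : ∀ i : T.tileIndex, y ∈ Phi β i +ᵥ T.tileD i ↔ -Phi β i + y ∈ T.tileD i := fun i => by
    rw [mem_vadd_set_iff_neg_vadd_mem, vadd_eq_add]
  rw [encard_eq_one]
  simp only [eq_singleton_iff_unique_mem, mem_ofPred_eq, hmem]
  constructor
  · rintro ⟨i, hi, hu⟩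
    refine ⟨⟨-i, neg_mem i.2.1⟩, ?_, ?_⟩
    · dsimp only
      rw [zero_sub, neg_neg, Phi_neg hβ.2.1 i.2.1, sub_neg_eq_add]
      exact ⟨i.2.2, hi⟩
    · rintro ⟨ξ, hξ⟩ ⟨h1, h2⟩
      dsimp only at h1 h2
      rw [zero_sub] at h1 h2
      have := hu ⟨-ξ, neg_mem hξ, h1⟩ (by
        rw [Phi_neg hβ.2.1 hξ, neg_neg]
        rwa [sub_neg_eq_add] at h2)
      refine Subtype.ext ?_
      rw [← this]
      exact (neg_neg ξ).symm
  · rintro ⟨⟨ξ, hξ⟩, ⟨h1, h2⟩, hu⟩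
    dsimp only at h1 h2
    rw [zero_sub] at h1 h2
    refine ⟨⟨-ξ, neg_mem hξ, h1⟩, ?_, ?_⟩
    · rw [Phi_neg hβ.2.1 hξ, neg_neg]
      rwa [sub_neg_eq_add] at h2
    · rintro ⟨i, hi, hiX⟩ h
      have := hu ⟨-i, neg_mem hi⟩ (by
        dsimp only at h ⊢
        rw [zero_sub, neg_neg, Phi_neg hβ.2.1 hi, sub_neg_eq_add]
        exact ⟨hiX, h⟩)
      refine Subtype.ext ?_
      have h3 : -i = ξ := congrArg Subtype.val this
      change i = -ξ
      rw [← h3, neg_neg]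

theorem finite_tiles_meeting_ball (y : hyperplane β) (r : ℝ) :
    {i : T.tileIndex | ((Phi β i +ᵥ T.tileD i) ∩ ball y r).Nonempty}.Finite := by
  obtain ⟨K, hK, hKD⟩ := exists_norm_tileD_le hβ hA
  obtain ⟨M, hM, hMX⟩ := T.exists_abs_le
  refine ((finite_adjoin_bounded hβ M (‖y‖ + r + K)).preimage
    (Subtype.val_injective.injOn (s := univ) |>.mono (subset_univ _))).subset ?_
  rintro ⟨i, hi, hiX⟩ ⟨_, ⟨g, hg, rfl⟩, hr⟩
  refine ⟨hi, hMX i hiX, ?_⟩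
  have h1 := hKD i hiX g hg
  rw [mem_ball, dist_eq_norm] at hr
  simp only [vadd_eq_add] at hr
  calc ‖Phi β i‖ = ‖(Phi β i + g - y) + y - g‖ := by congr 1; abel
    _ ≤ ‖Phi β i + g - y‖ + ‖y‖ + ‖g‖ :=
      (norm_sub_le _ _).trans (add_le_add_left (norm_add_le _ _) _)
    _ ≤ _ := by linarith

theorem finite_translates_meeting_ball (y : Space β) (r : ℝ) :
    {n | ((intVec β n +ᵥ T.natExtClosure) ∩ ball y r).Nonempty}.Finite := by
  obtain ⟨B, hB⟩ := (isCompact_natExtClosure hβ hA).isBounded.exists_norm_le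
  refine (finite_intVec_norm_le (‖y‖ + r + B)).subset ?_
  rintro n ⟨_, ⟨z, hz, rfl⟩, hr⟩
  have h1 := hB z hz
  rw [mem_ball, dist_eq_norm] at hr
  simp only [vadd_eq_add] at hr
  calc ‖intVec β n‖ = ‖(intVec β n + z - y) + y - z‖ := by congr 1; abel
    _ ≤ ‖intVec β n + z - y‖ + ‖y‖ + ‖z‖ :=
      (norm_sub_le _ _).trans (add_le_add_left (norm_add_le _ _) _)
    _ ≤ _ := by linarith

omit hβ hA in
/-- A locally finite family of closed sets that covers almost every point covers every point. -/
theorem forall_exists_mem_of_ae {E ι : Type*} [NormedAddCommGroup E] [MeasurableSpace E]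
    {μ : Measure E} [μ.IsOpenPosMeasure] {f : ι → Set E} (hf : LocallyFinite f)
    (hcl : ∀ i, IsClosed (f i)) (h : ∀ᵐ y ∂μ, ∃ i, y ∈ f i) (y : E) : ∃ i, y ∈ f i := by
  have h1 : Dense (⋃ i, f i) := by
    have := Measure.dense_of_ae h
    refine this.mono fun y hy => ?_
    exact mem_iUnion.2 hy
  have h2 := (hf.isClosed_iUnion hcl).closure_eq
  rw [h1.closure_eq] at h2
  exact mem_iUnion.1 (h2 ▸ mem_univ y)

omit hβ hA in
theorem locallyFinite_of_ball {E ι : Type*} [NormedAddCommGroup E] {f : ι → Set E}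
    (h : ∀ (y : E) (r : ℝ), {i | (f i ∩ ball y r).Nonempty}.Finite) : LocallyFinite f :=
  fun y => ⟨ball y 1, ball_mem_nhds y one_pos, h y 1⟩

/-- Near `φ(w)`, the fiber over `x` contains a small copy of the fiber over `y n`. As `M_β^n` is
open on `H`, the copy has interior points, at distance at most `2 K ρ^n` from `φ(w)`. -/
theorem closure_interior_tileD (hint : ∀ x ∈ T.X, (interior (T.tileD x)).Nonempty) {x : ℝ}
    (hx : x ∈ T.X) : closure (interior (T.tileD x)) = T.tileD x := by
  obtain ⟨K, ρ, hK⟩ := exists_phiBound hβ hA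
  have hS := T.isBranchSystem hA
  refine Subset.antisymm (closure_minimal interior_subset (isCompact_tileD hβ hA hx).isClosed) ?_
  intro g hg
  rw [tileD_eq_fiber hβ.1 hA hx] at hg ⊢
  obtain ⟨w, ⟨y, hc⟩, rfl⟩ := hg
  rw [Metric.mem_closure_iff]
  intro ε hε
  obtain ⟨n, hn⟩ := ((hK.tendsto.const_mul 2).eventually_lt_const (by simpa using hε)).exists
  have hy : y n ∈ T.X := hS.chain_mem hc n
  obtain ⟨g, hg⟩ := hint _ hy
  rw [tileD_eq_fiber hβ.1 hA hy] at hg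
  set F : hyperplane β → hyperplane β :=
    fun h => Phi β (β ^ n * y n - x) + (shiftH hβ ^ n) h with hF
  have hopen : IsOpenMap F := (isOpenMap_add_left _).comp (isOpenMap_shiftH_pow hβ n)
  have hsub : F '' interior (fiber β T.A T.piece (y n)) ⊆
      interior (fiber β T.A T.piece x) := by
    refine interior_maximal ?_ (hopen _ isOpen_interior)
    rintro _ ⟨h, hh, rfl⟩
    exact (hS.add_shiftH_pow_mem_fiber hβ hK hc n (interior_subset hh)).1
  refine ⟨F g, hsub ⟨g, hg, rfl⟩, ?_⟩
  rw [dist_comm, dist_eq_norm]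
  exact (hS.add_shiftH_pow_mem_fiber hβ hK hc n (interior_subset hg)).2.trans_lt hn

/-- If the tiles `𝒯_x` cover almost every point once, then they form a tiling. -/
theorem tilesHyperplane_and_interior (hsupp : T.X ⊆ T.invMeasure.support) (hV : T.V.Finite)
    (h : ∀ᵐ g ∂hyperplaneMeasure β, T.CoveredOnce 0 g) :
    T.TilesHyperplane ∧ ∀ x ∈ T.X, (interior (T.tileD x)).Nonempty := by
  let f : T.tileIndex → Set (hyperplane β) := fun i => Phi β i +ᵥ T.tileD i
  have hae : ∀ᵐ y ∂hyperplaneMeasure β, {i | y ∈ f i}.encard = 1 := by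
    filter_upwards [(Measure.measurePreserving_neg
      (hyperplaneMeasure β)).quasiMeasurePreserving.ae h] with y hy
    exact (encard_tile_eq_one_iff hβ y).2 hy
  have hlf : LocallyFinite f := locallyFinite_of_ball (finite_tiles_meeting_ball hβ hA)
  have hcl : ∀ i, IsClosed (f i) := fun i => (isCompact_tileD hβ hA i.2.2).isClosed.vadd _
  have hcov : ∀ y, ∃ i, y ∈ f i := by
    refine forall_exists_mem_of_ae hlf hcl (hae.mono fun y hy => ?_)
    obtain ⟨i, hi⟩ := encard_eq_one.1 hy
    exact ⟨i, (hi ▸ mem_singleton i : i ∈ {i | y ∈ f i})⟩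
  have hint' : ∀ i : T.tileIndex, (interior (T.tileD i)).Nonempty := by
    intro i
    have h1 : ∀ᵐ g ∂hyperplaneMeasure β, {j | Phi β i + g ∈ f j}.encard = 1 :=
      (measurePreserving_add_left (hyperplaneMeasure β) (Phi β i)).quasiMeasurePreserving.ae hae
    obtain ⟨g, hg, hu⟩ : ∃ g ∈ T.tileD i, {j | Phi β i + g ∈ f j}.encard = 1 := by
      by_contra! hno
      refine measure_tileD_ne_zero hβ hA hsupp hV i.2.2 (measure_eq_zero_iff_ae_notMem.2 ?_)
      filter_upwards [h1] with g hg hgi using hno g hgi hg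
    -- The complement of the other tiles is open by local finiteness and lies inside tile `i` by
    -- covering. It contains the once-covered point `Φ(i) + g`, which is thus interior.
    let U : Set (hyperplane β) := (⋃ j : {j // j ≠ i}, f j)ᶜ
    have hU : IsOpen U := ((hlf.comp_injective Subtype.val_injective).isClosed_iUnion
      fun j => hcl j.1).isOpen_compl
    have hUi : U ⊆ f i := fun y hy => by
      obtain ⟨j, hj⟩ := hcov y
      by_cases hji : j = i
      · exact hji ▸ hj
      · exact absurd (mem_iUnion.2 ⟨⟨j, hji⟩, hj⟩) hy
    have hgU : Phi β i + g ∈ U := by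
      intro hmem
      obtain ⟨⟨j, hji⟩, hj⟩ := mem_iUnion.1 hmem
      obtain ⟨k, hk⟩ := encard_eq_one.1 hu
      have hjk : j ∈ ({k} : Set T.tileIndex) := hk ▸ hj
      have hik : i ∈ ({k} : Set T.tileIndex) := hk ▸ (⟨g, hg, rfl⟩ : Phi β i + g ∈ f i)
      exact hji (hjk.trans hik.symm)
    refine ⟨g, mem_interior.2 ⟨(fun h => Phi β i + h) ⁻¹' U, fun h hh => ?_,
      hU.preimage (continuous_const_add _), hgU⟩⟩
    have := hUi hh
    simpa [f, mem_vadd_set_iff_neg_vadd_mem] using this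
  have hint : ∀ x ∈ T.X, (interior (T.tileD x)).Nonempty := by
    intro x hx
    obtain ⟨b, hb, hI⟩ := mem_nhdsGE_iff_exists_Ico_subset.1 (eventually_tileD_nhdsGE hβ hA hV hx)
    -- Tiles are indexed by `ℤ[β] ∩ X` only; any other `x` shares its fiber with a nearby `ξ` on its
    -- right.
    obtain ⟨ξ, hξ, hξ'⟩ := (dense_adjoin hβ).exists_between (show x < b from hb)
    obtain ⟨h1, h2⟩ := hI (Ioo_subset_Ico_self hξ')
    rw [← h2]
    exact hint' ⟨ξ, hξ, h1⟩
  refine ⟨⟨?_, fun i => isCompact_tileD hβ hA i.2.2,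
    fun y => ⟨1, one_pos, finite_tiles_meeting_ball hβ hA y 1⟩, hcov,
    fun i => closure_interior_tileD hβ hA hint i.2.2, le_rfl, ?_⟩, hint⟩
  · refine (finite_tileD hβ hA hV).subset ?_
    rintro _ ⟨i, rfl⟩
    exact ⟨i, i.2.2, rfl⟩
  · exact hae.mono fun y hy => by rw [hy, Nat.cast_one]

/-- Since the fiber stays equal to `𝒟_x` on some `[x, b)`, the open box `(x, b) × (-int 𝒟_x)` lies
in `X̂`, and its closure contains all points of `X̂` over `x`. -/
theorem closure_interior_natExtClosure (hV : T.V.Finite)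
    (hint : ∀ x ∈ T.X, (interior (T.tileD x)).Nonempty) :
    closure (interior T.natExtClosure) = T.natExtClosure := by
  have hclosed : IsClosed T.natExtClosure := (isCompact_natExtClosure hβ hA).isClosed
  refine Subset.antisymm (closure_minimal interior_subset hclosed) ?_
  have hsub : T.natExt ⊆ closure (interior T.natExtClosure) := by
    intro y hy
    obtain ⟨⟨x, g⟩, rfl⟩ := (coordEquiv hβ).surjective y
    obtain ⟨hx, hg⟩ := (coordEquiv_mem_natExt hβ hA).1 hy
    obtain ⟨b, hb, hI⟩ := mem_nhdsGE_iff_exists_Ico_subset.1 (eventually_tileD_nhdsGE hβ hA hV hx)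
    let W : Set (ℝ × hyperplane β) := Ioo x b ×ˢ (-interior (T.tileD x))
    have hW : IsOpen W := isOpen_Ioo.prod isOpen_interior.neg
    have hWsub : coordEquiv hβ '' W ⊆ interior T.natExtClosure := by
      refine interior_maximal ?_ ((coordEquiv hβ).toHomeomorph.isOpenMap _ hW)
      rintro _ ⟨⟨t, h⟩, ⟨ht, hh⟩, rfl⟩
      rw [natExtClosure_eq hβ hA]
      refine subset_closure ((coordEquiv_mem_natExt hβ hA).2 ?_)
      obtain ⟨h1, h2⟩ := hI (Ioo_subset_Ico_self ht)
      exact ⟨h1, h2 ▸ interior_subset hh⟩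
    have hmem : (x, g) ∈ closure W := by
      rw [closure_prod_eq, closure_Ioo (ne_of_lt hb)]
      refine ⟨left_mem_Icc.2 (le_of_lt hb), ?_⟩
      rw [← neg_closure, Set.mem_neg, closure_interior_tileD hβ hA hint hx]
      exact hg
    exact closure_mono hWsub
      (image_closure_subset_closure_image (coordEquiv hβ).continuous ⟨_, hmem, rfl⟩)
  have h := closure_minimal hsub isClosed_closure
  rwa [← natExtClosure_eq hβ hA] at h

theorem tilesHyperplane_iff (hsupp : T.X ⊆ T.invMeasure.support) (hV : T.V.Finite) :
    T.TilesHyperplane ↔ ∀ᵐ y : Space β, ∃! n, y - intVec β n ∈ T.natExt := by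
  rw [ae_existsUnique_intVec_iff hβ hA hV]
  refine ⟨fun h => ?_, fun h => (tilesHyperplane_and_interior hβ hA hsupp hV h).1⟩
  filter_upwards [(Measure.measurePreserving_neg
    (hyperplaneMeasure β)).quasiMeasurePreserving.ae h.ae_covered] with g hg
  rw [Nat.cast_one, encard_tile_eq_one_iff hβ, neg_neg] at hg
  exact hg

theorem tilesSpace_iff (hsupp : T.X ⊆ T.invMeasure.support) (hV : T.V.Finite) :
    T.TilesSpace ↔ ∀ᵐ y : Space β, ∃! n, y - intVec β n ∈ T.natExt := by
  constructor
  · intro h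
    filter_upwards [h.ae_covered, ae_natExtClosure hβ hA hV] with y hy hy'
    have := (encard_space_eq_one_iff y T.natExtClosure).1 hy
    simpa only [hy'] using this
  · intro h
    have hae : ∀ᵐ y : Space β, {n | y ∈ intVec β n +ᵥ T.natExtClosure}.encard = 1 := by
      filter_upwards [h, ae_natExtClosure hβ hA hV] with y hy hy'
      rw [encard_space_eq_one_iff]
      simpa only [hy'] using hy
    -- Interior points of the fibers are obtained from the tiling of the slice `H`.
    have hint := (tilesHyperplane_and_interior hβ hA hsupp hV
      ((ae_existsUnique_intVec_iff hβ hA hV).1 h)).2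
    have hcomp := isCompact_natExtClosure hβ hA
    refine ⟨finite_range_const, fun _ => hcomp,
      fun y => ⟨1, one_pos, finite_translates_meeting_ball hβ hA y 1⟩,
      forall_exists_mem_of_ae (f := fun n => intVec β n +ᵥ T.natExtClosure) (μ := volume)
        (locallyFinite_of_ball (finite_translates_meeting_ball hβ hA))
        (fun n => hcomp.isClosed.vadd _) (hae.mono fun y hy => ?_),
      fun _ => closure_interior_natExtClosure hβ hA hV hint, le_rfl,
      hae.mono fun y hy => by rw [Nat.cast_one]; exact hy⟩
    obtain ⟨i, hi⟩ := encard_eq_one.1 hy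
    exact ⟨i, (hi ▸ mem_singleton i : i ∈ {n | y ∈ intVec β n +ᵥ T.natExtClosure})⟩

end BetaTransformation

end BetaTiling

end

theorem propositionp {β : ℝ} (hβ : BetaTiling.IsPisotUnit β)
    (T : BetaTiling.BetaTransformation β)
    (hA : ∀ a ∈ T.A, a ∈ Algebra.adjoin ℤ {β})
    (hsupp : T.X ⊆ T.invMeasure.support)
    (hV : T.V.Finite) :
    (T.TilesSpace ↔ T.TilesHyperplane) ∧ (T.TilesSpace ↔ T.TilesTorus) := by
  rw [BetaTiling.BetaTransformation.tilesSpace_iff hβ hA hsupp hV,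
    BetaTiling.BetaTransformation.tilesHyperplane_iff hβ hA hsupp hV,
    BetaTiling.BetaTransformation.tilesTorus_iff]
  exact ⟨Iff.rfl, Iff.rfl⟩
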